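/- **Setting.** Let $s\ge 1$, let $Q\subset\mathbb R^d$, and for $t=1,\dots,s$ let $D_t=\{x^{(t)}_1,\dots,x^{(t)}_{n_t}\}\subset Q$ be design sets with $D_s\subseteq\dots\subseteq D_1$. Let $f_t:Q\to\mathbb R^{p_t}$ ($1\le t\le s$) and $f_{\rho_{t-1}}:Q\to\mathbb R^{q_{t-1}}$ ($2\le t\le s$) be regression functions, and let $r_t(\cdot\,;\theta_t)$ be correlation functions with fixed hyper-parameters $\theta_t$ such that the matrix $R_t=\big(r_t(x^{(t)}_i-x^{(t)}_j;\theta_t)\big)_{i,j}$ is positive definite for every $t$. Given coefficients $\beta_t\in\mathbb R^{p_t}$, $\beta_{\rho_{t-1}}\in\mathbb R^{q_{t-1}}$ and variances $\sigma_t^2>0$, the process $Z_1$ is Gaussian with mean $f_1^T\beta_1$ and covariance $\sigma_1^2 r_1(x-x';\theta_1)$, and for $t\ge2$ $$Z_t(x)=\rho_{t-1}(x)Z_{t-1}(x)+\delta_t(x),\qquad \rho_{t-1}(x)=f_{\rho_{t-1}}(x)^T\beta_{\rho_{t-1}},$$ where $\delta_t$ is a Gaussian process with mean $f_t^T\beta_t$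 and covariance $\sigma_t^2r_t(x-x';\theta_t)$, independent of $(Z_1,\dots,Z_{t-1})$. (Constant $\rho_{t-1}$ is the case $q_{t-1}=1$, $f_{\rho_{t-1}}=1$, where $\rho_{t-1}=\beta_{\rho_{t-1}}$.) The observations are $z_t\in\mathbb R^{n_t}$, the values of $Z_t$ on $D_t$; $z_{t-1}(D_t)$ is the subvector of $z_{t-1}$ belonging to the points of $D_t\subseteq D_{t-1}$. Let $F_t(D_t)$ and $F_{\rho_{t-1}}(D_t)$ be the matrices with rows $f_t(x^{(t)}_i)^T$ and $f_{\rho_{t-1}}(x^{(t)}_i)^T$, and put $H_1=F_1(D_1)$, $\lambda_1=\beta_1$, $k_1=p_1$, and for $t\ge 2$, with $\odot$ the entrywise product, $$H_t=\big[F_{\rho_{t-1}}(D_t)\odot (z_{t-1}(D_t)\mathbf 1_{q_{t-1}}^T)\quad F_t(D_t)\big],\qquad \lambda_t=(\beta_{\rho_{t-1}},\beta_t),\qquad k_t=p_t+q_{t-1},$$ so that $H_t=[z_{t-1}(D_t)\ \ F_t(D_t)]$ and $k_t=p_t+1$ when $\rho_{t-1}$ is constant. Whenever $H_t$ has linearly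 independent columns, put $$\hat\lambda_t=(H_t^TR_t^{-1}H_t)^{-1}H_t^TR_t^{-1}z_t,\qquad Q_t=(z_t-H_t\hat\lambda_t)^TR_t^{-1}(z_t-H_t\hat\lambda_t),\qquad \alpha_t=\frac{n_t-k_t}{2}.$$ The priors are the Jeffreys priors: $p(\lambda_t\mid\sigma_t^2)\propto1$, $p(\sigma_t^2)\propto1/\sigma_t^2$, independently over $t$. Posteriors are given by the Bayes formula (likelihood times prior, normalized, the normalizing constant being positive and finite). For $t\ge 2$, the posteriors of $\lambda_t,\sigma_t^2$ given $z_t,z_{t-1}$ use as likelihood the conditional density of $Z_t(D_t)$ at $z_t$ given $Z_{t-1}(D_{t-1})=z_{t-1}$ (they do not depend on the parameters of the other levels, which are held fixed); for $t=1$ the likelihood is the density of $Z_1(D_1)$ at $z_1$. $\mathcal{IG}(\alpha,Q)$ has density $\frac{Q^\alpha}{\Gamma(\alpha)}\frac{e^{-Q/x}}{x^{\alpha+1}}\mathbf 1_{x>0}$. **Statement.** 1. For each $t$ such that $H_t$ has linearly independent columns, and each $\sigma_t^2>0$, $$[\lambda_t\mid z_t,z_{t-1},\theta_t,\sigma_t^2]\sim\mathcal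 N\big(\hat\lambda_t,\ \sigma_t^2(H_t^TR_t^{-1}H_t)^{-1}\big)$$ (without $z_{t-1}$ if $t=1$). 2. If moreover $z_t$ is not in the column space of $H_t$ (which forces $n_t>k_t$ and $Q_t>0$), then $$[\sigma_t^2\mid z_t,z_{t-1},\theta_t]\sim\mathcal{IG}\big(\alpha_t,\tfrac{Q_t}{2}\big),$$ and the joint posterior of $(\lambda_t,\sigma_t^2)$ is this law of $\sigma_t^2$ combined with the Gaussian law of part 1 for $\lambda_t$ given $\sigma_t^2$. 3. (Decoupling.) If the conditions of parts 1 and 2 hold for all $t=1,\dots,s$, then the posterior of all the parameters $(\lambda_t,\sigma_t^2)_{t=1,\dots,s}$ given all the observations $z_1,\dots,z_s$ is the product over $t$ of the posteriors of part 2, and the $t$-th factor is the posterior, under the Jeffreys prior, of the one-level kriging model in which the observation vector $z_t$ has law $\mathcal N(H_t\lambda_t,\sigma_t^2R_t)$ with $H_t$ a fixed design matrix. So the parameter estimation is that of $s$ independent krigings. -/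

import Mathlib

open MeasureTheory ProbabilityTheory Matrix
open scoped ENNReal NNReal

noncomputable section

namespace CoKriging

/-! ### Bayes formula with possibly improper priors -/

section Bayes

variable {Par Ω E F : Type*} [MeasurableSpace Par] [MeasurableSpace Ω]

/-- Bayes formula: `post = likelihood * prior / evidence`, where `lik` is the likelihood at the
observed data. The prior may be improper (infinite), but the evidence, i.e. the total mass of
`likelihood * prior`, has to be positive and finite. -/
def IsBayesUpdate (prior : Measure Par) (lik : Par → ℝ≥0) (post : Measure Par) : Prop :=
  AEMeasurable lik prior ∧
  (∫⁻ a, (lik a : ℝ≥0∞) ∂prior) ≠ 0 ∧ (∫⁻ a, (lik a : ℝ≥0∞) ∂prior) ≠ ∞ ∧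
  post = (∫⁻ a, (lik a : ℝ≥0∞) ∂prior)⁻¹ • prior.withDensity (fun a => (lik a : ℝ≥0∞))

/-- `post` is the posterior distribution `[a | Y = y]` of the parameter `a` with prior `prior`,
when `P a` is the probability measure on `Ω` given the parameter `a`. The likelihood is the
(unique) continuous version of the probability density `L a` of `Y` under `P a`. -/
def IsPosterior [TopologicalSpace F] [MeasureSpace F] (prior : Measure Par) (P : Par → Measure Ω)
    (Y : Ω → F) (y : F) (post : Measure Par) : Prop :=
  ∃ L : Par → F → ℝ≥0,
    (∀ᵐ a ∂prior, Continuous (L a) ∧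
      (P a).map Y = (volume : Measure F).withDensity (fun b => (L a b : ℝ≥0∞))) ∧
    IsBayesUpdate prior (fun a => L a y) post

/-- `post` is the posterior distribution `[a | Y = y, X = x]` of the parameter `a`, where the
likelihood is the conditional density of `Y` given `X` under `P a`: the continuous `L a` such that
the law of `(X, Y)` is `law(X)(dx) L a (x, y) dy`. As `law(X)` is asked to charge all nonempty open
sets, there is at most one such `L a`. -/
def IsCondPosterior [TopologicalSpace E] [MeasurableSpace E] [TopologicalSpace F] [MeasureSpace F]
    (prior : Measure Par) (P : Par → Measure Ω) (X : Ω → E) (x : E) (Y : Ω → F) (y : F)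
    (post : Measure Par) : Prop :=
  ∃ L : Par → E × F → ℝ≥0,
    (∀ᵐ a ∂prior, ((P a).map X).IsOpenPosMeasure ∧ Continuous (L a) ∧
      (P a).map (fun ω => (X ω, Y ω)) =
        (((P a).map X).prod (volume : Measure F)).withDensity (fun b => (L a b : ℝ≥0∞))) ∧
    IsBayesUpdate prior (fun a => L a (x, y)) post

end Bayes

/-! ### Jeffreys priors, inverse gamma distribution -/

/-- The improper prior `p(v) ∝ 1 / v` on the variance `v > 0`. -/
def jeffreysVariance : Measure ℝ :=
  (volume.restrict (Set.Ioi 0)).withDensity (fun v => ENNReal.ofReal (1 / v))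

/-- The Jeffreys prior on (regression coefficients, variance): flat in the coefficients and
`1 / v` in the variance. -/
def jeffreysPrior (κ : Type*) [Fintype κ] : Measure (EuclideanSpace ℝ κ × ℝ) :=
  (volume : Measure (EuclideanSpace ℝ κ)).prod jeffreysVariance

/-- The inverse gamma distribution `IG(α, Q)`, with density
`Q ^ α / Γ(α) * exp (-Q / x) / x ^ (α + 1)` on `x > 0`. -/
def invGamma (α Q : ℝ) : Measure ℝ :=
  volume.withDensity (fun x => ENNReal.ofReal
    (if 0 < x then Q ^ α / Real.Gamma α * (Real.exp (-(Q / x)) / x ^ (α + 1)) else 0))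

/-! ### Kriging with design matrix `H`, correlation matrix `R` and observations `y` -/

section Kriging

variable {ι κ : Type*} [Fintype ι] [DecidableEq ι] [Fintype κ] [DecidableEq κ]

/-- `(Hᵀ R⁻¹ H)⁻¹` -/
def coefCov (H : Matrix ι κ ℝ) (R : Matrix ι ι ℝ) : Matrix κ κ ℝ :=
  (Hᵀ * R⁻¹ * H)⁻¹

/-- `(Hᵀ R⁻¹ H)⁻¹ Hᵀ R⁻¹ y` -/
def coefMean (H : Matrix ι κ ℝ) (R : Matrix ι ι ℝ) (y : EuclideanSpace ℝ ι) :
    EuclideanSpace ℝ κ :=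
  WithLp.toLp 2 (((Hᵀ * R⁻¹ * H)⁻¹ * Hᵀ * R⁻¹) *ᵥ y.ofLp)

/-- `(y - H b)ᵀ R⁻¹ (y - H b)` with `b = (Hᵀ R⁻¹ H)⁻¹ Hᵀ R⁻¹ y` -/
def residualForm (H : Matrix ι κ ℝ) (R : Matrix ι ι ℝ) (y : EuclideanSpace ℝ ι) : ℝ :=
  (y.ofLp - H *ᵥ (coefMean H R y).ofLp) ⬝ᵥ (R⁻¹ *ᵥ (y.ofLp - H *ᵥ (coefMean H R y).ofLp))

/-- The posterior of (coefficients `b`, variance `v`) announced for a kriging model: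
`v` has law `IG(α, Q / 2)` and, given `v`, the vector `b` has law
`N((Hᵀ R⁻¹ H)⁻¹ Hᵀ R⁻¹ y, v (Hᵀ R⁻¹ H)⁻¹)`. -/
structure IsGaussianInvGamma (H : Matrix ι κ ℝ) (R : Matrix ι ι ℝ) (y : EuclideanSpace ℝ ι)
    (α : ℝ) (post : Measure (EuclideanSpace ℝ κ × ℝ)) : Prop where
  isProbabilityMeasure : IsProbabilityMeasure post
  variance_law : post.map Prod.snd = invGamma α (residualForm H R y / 2)
  coef_law_given_variance : ∀ (A : Set (EuclideanSpace ℝ κ)) (B : Set ℝ),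
    MeasurableSet A → MeasurableSet B →
    post (A ×ˢ B) = ∫⁻ v in B, multivariateGaussian (coefMean H R y) (v • coefCov H R) A
      ∂(invGamma α (residualForm H R y / 2))

/-- The one-level kriging model at the observation points: given the coefficients `b` and the
variance `v`, the observation vector has law `N(H b, v R)`. -/
def krigingLaw (H : Matrix ι κ ℝ) (R : Matrix ι ι ℝ) (a : EuclideanSpace ℝ κ × ℝ) :
    Measure (EuclideanSpace ℝ ι) :=
  multivariateGaussian (WithLp.toLp 2 (H *ᵥ a.1.ofLp)) (a.2 • R)

end Kriging

/-! ### The autoregressive multi-level model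

There are `m + 1` levels, indexed by `Fin (m + 1)`; the level `i.succ` is obtained from the level
`i.castSucc`, for `i : Fin m`. -/

section Model

variable {m d : ℕ}

/-- Parameters: `(β, σ²)` of the first level, and for each transition `i` the pair
`((βρ, β), σ²)` with `βρ` the coefficients of the scale factor between `i.castSucc` and `i.succ`,
and `β`, `σ²` the trend coefficients and the variance of the level `i.succ`. -/
abbrev Params (p : Fin (m + 1) → ℕ) (q : Fin m → ℕ) : Type :=
  (EuclideanSpace ℝ (Fin (p 0)) × ℝ) ×
    ((i : Fin m) → EuclideanSpace ℝ (Fin (q i) ⊕ Fin (p i.succ)) × ℝ)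

variable {p : Fin (m + 1) → ℕ} {q : Fin m → ℕ}

/-- All the variances are positive. -/
def PosVariances (ψ : Params p q) : Prop :=
  0 < ψ.1.2 ∧ ∀ i, 0 < (ψ.2 i).2

/-- Product of the Jeffreys priors of the levels. -/
def paramPrior (p : Fin (m + 1) → ℕ) (q : Fin m → ℕ) : Measure (Params p q) :=
  (jeffreysPrior (Fin (p 0))).prod
    (Measure.pi fun i : Fin m => jeffreysPrior (Fin (q i) ⊕ Fin (p i.succ)))

variable {D : Set (EuclideanSpace ℝ (Fin d))} {Ω : Type*}

/-- The scale factor `ρ(u) = fρ(u)ᵀ βρ` of the transition `i`. -/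
def scale (fρ : (i : Fin m) → D → Fin (q i) → ℝ) (ψ : Params p q) (i : Fin m) (u : D) : ℝ :=
  ∑ k, fρ i u k * (ψ.2 i).1 (Sum.inl k)

/-- The discrepancy process `δ(u) = Z_t(u) - ρ(u) Z_{t-1}(u)` of the transition `i`. -/
def discrepancy (fρ : (i : Fin m) → D → Fin (q i) → ℝ) (Z : Fin (m + 1) → D → Ω → ℝ)
    (ψ : Params p q) (i : Fin m) (u : D) (ω : Ω) : ℝ :=
  Z i.succ u ω - scale fρ ψ i u * Z i.castSucc u ω

/-- Under `P`, the processes `Z` on the domain `D` follow the autoregressive model with parameters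
`ψ`, regression functions `f`, `fρ` and correlation functions `r`. -/
structure IsARModel [MeasurableSpace Ω]
    (f : (t : Fin (m + 1)) → D → Fin (p t) → ℝ) (fρ : (i : Fin m) → D → Fin (q i) → ℝ)
    (r : Fin (m + 1) → EuclideanSpace ℝ (Fin d) → ℝ)
    (Z : Fin (m + 1) → D → Ω → ℝ) (ψ : Params p q) (P : Measure Ω) : Prop where
  isProbabilityMeasure : IsProbabilityMeasure P
  measurable : ∀ t u, Measurable (Z t u)
  first_gaussian : IsGaussianProcess (Z 0) P
  first_mean : ∀ u, ∫ ω, Z 0 u ω ∂P = ∑ k, f 0 u k * ψ.1.1 k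
  first_cov : ∀ u u' : D, covariance (Z 0 u) (Z 0 u') P = ψ.1.2 * r 0 (u - u')
  disc_gaussian : ∀ i, IsGaussianProcess (discrepancy fρ Z ψ i) P
  disc_mean : ∀ i u, ∫ ω, discrepancy fρ Z ψ i u ω ∂P =
    ∑ k, f i.succ u k * (ψ.2 i).1 (Sum.inr k)
  disc_cov : ∀ i (u u' : D), covariance (discrepancy fρ Z ψ i u) (discrepancy fρ Z ψ i u') P =
    (ψ.2 i).2 * r i.succ (u - u')
  disc_indep : ∀ i, IndepFun (fun ω (u : D) => discrepancy fρ Z ψ i u ω)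
    (fun ω (tu : {t : Fin (m + 1) // t ≤ i.castSucc} × D) => Z tu.1 tu.2 ω) P

/-- The correlation matrix `R(x, x)` of the points `x j`. -/
def corrMatrix {n : ℕ} (r : EuclideanSpace ℝ (Fin d) → ℝ) (x : Fin n → D) :
    Matrix (Fin n) (Fin n) ℝ :=
  Matrix.of fun j k => r ((x j : EuclideanSpace ℝ (Fin d)) - x k)

/-- The matrix with rows `g(x j)ᵀ`. -/
def regMatrix {n k : ℕ} (g : D → Fin k → ℝ) (x : Fin n → D) : Matrix (Fin n) (Fin k) ℝ :=
  Matrix.of fun j => g (x j)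

/-- The block matrix `[Fρ ⊙ (w 1ᵀ)  F]`. -/
def coDesign {n a b : ℕ} (Fρ : Matrix (Fin n) (Fin a) ℝ) (w : Fin n → ℝ)
    (F : Matrix (Fin n) (Fin b) ℝ) : Matrix (Fin n) (Fin a ⊕ Fin b) ℝ :=
  Matrix.fromCols (Matrix.of fun j k => Fρ j k * w j) F

/-- The vector `Z_t(D_t)` of the values of the process `Z_t` at the design points. -/
def obs {n : ℕ} (Zt : D → Ω → ℝ) (x : Fin n → D) (ω : Ω) : EuclideanSpace ℝ (Fin n) :=
  WithLp.toLp 2 fun j => Zt (x j) ω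

/-- The parameters `ψ` where the parameters of the transition `i` are replaced by `a`. -/
def replaceLevel (ψ : Params p q) (i : Fin m)
    (a : EuclideanSpace ℝ (Fin (q i) ⊕ Fin (p i.succ)) × ℝ) : Params p q :=
  (ψ.1, Function.update ψ.2 i a)

end Model

end CoKriging

end

/-! Condition level t on level t-1. As D_t ⊆ D_{t-1}, the vector Z_{t-1}(D_t) is a subvector of the
data, and Z_t(D_t) = ρ ⊙ Z_{t-1}(D_t) + δ_t(D_t), where δ_t(D_t) is Gaussian and independent of the
lower levels. Hence the conditional law of Z_t(D_t) is N(H_t λ_t, σ_t² R_t), and z_{t-1} enters only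
through H_t (`normalDensity_sub_scaledRestrict`, `IsARModel.map_obs_castSucc_succ`). Iterating, the
joint density of all observations is the product of these kriging densities
(`map_chain_eq_withDensity`, `IsARModel.map_obs`). At fixed data the t-th factor depends on (λ_t,
σ_t²) alone and the prior is a product measure, so the Bayes formula splits by Tonelli
(`IsBayesUpdate.prod`, `IsBayesUpdate.pi`).

It remains to treat one kriging with n observations and k coefficients. The generalized least
squares residual is R⁻¹-orthogonal to the columns of H, so the likelihood is a function of the
variance v times a Gaussian density in the coefficients b (`quadForm_eq`,
`normalDensity_eq_profileFactor_mul`); this is the posterior for known v. Integrating b out leaves a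
multiple of v^(-(n-k)/2) exp(-Q/(2v)), which the prior 1/v turns into an inverse gamma density with
α = (n-k)/2 (`profileFactor_eq`). Data outside the column space of H give Q > 0 and n > k, so the
evidence is positive and finite. -/

noncomputable section

namespace CoKriging

/-! ### Densities of image measures and of product measures -/

section General

theorem map_withDensity_comp {α β : Type*} [MeasurableSpace α] [MeasurableSpace β] {μ : Measure α}
    {T : α → β} (hT : Measurable T) {G : β → ℝ≥0∞} (hG : Measurable G) :
    (μ.withDensity (G ∘ T)).map T = (μ.map T).withDensity G := by
  ext s hs
  rw [Measure.map_apply hT hs, withDensity_apply _ (hT hs), withDensity_apply _ hs,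
    setLIntegral_map hs hG hT]
  rfl

theorem lintegral_fin_prod_eq_prod {n : ℕ} {E : Fin n → Type*} [∀ i, MeasurableSpace (E i)]
    (μ : ∀ i, Measure (E i)) [∀ i, SigmaFinite (μ i)] {f : ∀ i, E i → ℝ≥0∞}
    (hf : ∀ i, Measurable (f i)) :
    ∫⁻ x, ∏ i, f i (x i) ∂(Measure.pi μ) = ∏ i, ∫⁻ x, f i x ∂(μ i) := by
  induction n with
  | zero => simp
  | succ n ih =>
    rw [← ((measurePreserving_piFinSuccAbove μ 0).symm).lintegral_comp_emb
      (MeasurableEquiv.measurableEmbedding _)]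
    rw [Fin.prod_univ_succ, ← ih (fun i => μ i.succ) fun i => hf i.succ,
      ← lintegral_prod_mul (hf 0).aemeasurable
      (Finset.measurable_prod _ fun i _ => by have := hf i.succ; fun_prop).aemeasurable]
    refine lintegral_congr fun y => ?_
    rw [Fin.prod_univ_succ]
    rfl

theorem lintegral_fintype_prod_eq_prod {ι : Type*} [Fintype ι] {E : ι → Type*}
    [∀ i, MeasurableSpace (E i)] (μ : ∀ i, Measure (E i)) [∀ i, SigmaFinite (μ i)]
    {f : ∀ i, E i → ℝ≥0∞} (hf : ∀ i, Measurable (f i)) :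
    ∫⁻ x, ∏ i, f i (x i) ∂(Measure.pi μ) = ∏ i, ∫⁻ x, f i x ∂(μ i) := by
  let e := (Fintype.equivFin ι).symm
  rw [← (measurePreserving_piCongrLeft _ e).lintegral_comp_emb
    (MeasurableEquiv.measurableEmbedding _)]
  simp_rw [← e.prod_comp, MeasurableEquiv.coe_piCongrLeft, Equiv.piCongrLeft_apply_apply]
  exact lintegral_fin_prod_eq_prod (fun i => μ (e i)) fun i => hf (e i)

/-- Both sides agree on boxes, by Tonelli. The `g i` may take the value ∞, so σ-finiteness of the
weighted measures has to be assumed. -/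
theorem pi_withDensity {ι : Type*} [Fintype ι] {α : ι → Type*} [∀ i, MeasurableSpace (α i)]
    (μ : ∀ i, Measure (α i)) [∀ i, SigmaFinite (μ i)] (g : ∀ i, α i → ℝ≥0∞)
    (hg : ∀ i, Measurable (g i)) [∀ i, SigmaFinite ((μ i).withDensity (g i))] :
    Measure.pi (fun i => (μ i).withDensity (g i)) =
      (Measure.pi μ).withDensity (fun x => ∏ i, g i (x i)) := by
  refine Measure.pi_eq fun s hs => ?_
  rw [withDensity_apply _ (MeasurableSet.univ_pi hs), Measure.restrict_pi_pi,
    lintegral_fintype_prod_eq_prod _ hg]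
  exact Finset.prod_congr rfl fun i _ => (withDensity_apply _ (hs i)).symm

end General

/-! ### Lebesgue density of a nondegenerate Gaussian vector -/

section Normal

variable {ι : Type*} [Fintype ι] [DecidableEq ι]

/-- The density at `y` of the Gaussian distribution `N(c, v R)`. -/
def normalDensity (R : Matrix ι ι ℝ) (v : ℝ) (c y : EuclideanSpace ℝ ι) : ℝ :=
  (√((2 * Real.pi * v) ^ Fintype.card ι * R.det))⁻¹ *
    Real.exp (-(((y - c).ofLp ⬝ᵥ R⁻¹ *ᵥ (y - c).ofLp) / (2 * v)))

theorem normalDensity_pos {R : Matrix ι ι ℝ} (hR : R.PosDef) {v : ℝ} (hv : 0 < v)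
    (c y : EuclideanSpace ℝ ι) : 0 < normalDensity R v c y := by
  have := hR.det_pos
  unfold normalDensity; positivity

theorem continuous_normalDensity {X : Type*} [TopologicalSpace X] (R : Matrix ι ι ℝ) (v : ℝ)
    {c y : X → EuclideanSpace ℝ ι} (hc : Continuous c) (hy : Continuous y) :
    Continuous fun a => normalDensity R v (c a) (y a) := by
  unfold normalDensity
  have : Continuous fun a => (y a - c a).ofLp := by fun_prop
  have h2 : Continuous fun a => R⁻¹ *ᵥ (y a - c a).ofLp := by fun_prop
  have h3 := this.dotProduct h2
  fun_prop

theorem measurable_normalDensity {X : Type*} [MeasurableSpace X] (R : Matrix ι ι ℝ) {v : X → ℝ}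
    {c y : X → EuclideanSpace ℝ ι} (hv : Measurable v) (hc : Measurable c) (hy : Measurable y) :
    Measurable fun a => normalDensity R (v a) (c a) (y a) := by
  unfold normalDensity
  have h3 : Measurable fun a => (y a - c a).ofLp ⬝ᵥ R⁻¹ *ᵥ (y a - c a).ofLp := by
    have : Continuous fun u : EuclideanSpace ℝ ι => u.ofLp ⬝ᵥ R⁻¹ *ᵥ u.ofLp := by
      have : Continuous fun a : EuclideanSpace ℝ ι => a.ofLp := by fun_prop
      have h2 : Continuous fun a : EuclideanSpace ℝ ι => R⁻¹ *ᵥ a.ofLp := by fun_prop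
      exact this.dotProduct h2
    exact this.measurable.comp (hy.sub hc)
  fun_prop

/-- The standard Gaussian is a product of one-dimensional ones, and `WithLp.toLp 2` preserves
volume. -/
theorem stdGaussian_eq_withDensity :
    stdGaussian (EuclideanSpace ℝ ι) = (volume : Measure (EuclideanSpace ℝ ι)).withDensity
      (fun x => ENNReal.ofReal (normalDensity (1 : Matrix ι ι ℝ) 1 0 x)) := by
  have hg : gaussianReal 0 1 = (volume : Measure ℝ).withDensity (gaussianPDF 0 1) :=
    gaussianReal_of_var_ne_zero _ one_ne_zero
  have : SigmaFinite ((volume : Measure ℝ).withDensity (gaussianPDF 0 1)) := by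
    rw [← hg]; infer_instance
  have hc : (fun x : EuclideanSpace ℝ ι =>
      ENNReal.ofReal (normalDensity (1 : Matrix ι ι ℝ) 1 0 x)) ∘ WithLp.toLp 2 =
      fun x : ι → ℝ => ∏ i, gaussianPDF 0 1 (x i) := by
    funext x
    simp only [Function.comp, gaussianPDF]
    rw [← ENNReal.ofReal_prod_of_nonneg fun i _ => gaussianPDFReal_nonneg 0 1 (x i)]
    congr 1
    simp only [normalDensity, gaussianPDFReal, Finset.prod_mul_distrib, ← Real.exp_sum]
    congr 1
    · have h : √((2 * Real.pi) ^ Fintype.card ι) = √(2 * Real.pi) ^ Fintype.card ι :=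
        (Real.sqrt_eq_iff_mul_self_eq (by positivity) (by positivity)).2
          (by rw [← mul_pow, Real.mul_self_sqrt (by positivity)])
      simp only [mul_one, det_one, h, NNReal.coe_one, Finset.prod_const, Finset.card_univ, inv_pow]
    · congr 1
      simp only [sub_zero, inv_one, one_mulVec, dotProduct, mul_one, NNReal.coe_one, sq,
        ← Finset.sum_div, Finset.sum_neg_distrib, neg_div]
  rw [← map_pi_eq_stdGaussian, hg, pi_withDensity _ _ fun _ => measurable_gaussianPDF 0 1, ← hc,
    map_withDensity_comp (by fun_prop)]
  · rw [← (EuclideanSpace.volume_preserving_symm_measurableEquiv_toLp ι).symm.map_eq]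
    rfl
  · exact (measurable_normalDensity _ measurable_const measurable_const measurable_id).ennreal_ofReal

open scoped MatrixOrder in
-- Change of variables: the law is the image of the standard Gaussian under x ↦ c + A x, with A the
-- symmetric square root of v R. Its Jacobian is det A, and A R⁻¹ A = v turns the quadratic form
-- into the squared norm of x.
theorem multivariateGaussian_eq_withDensity {R : Matrix ι ι ℝ} (hR : R.PosDef) {v : ℝ}
    (hv : 0 < v) (c : EuclideanSpace ℝ ι) :
    multivariateGaussian c (v • R) = volume.withDensity
      (fun y => ENNReal.ofReal (normalDensity R v c y)) := by
  set S := v • R with hS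
  have hSpos : S.PosDef := hR.smul hv
  set A := CFC.sqrt S with hA
  have hAA : A * A = S := CFC.sqrt_mul_sqrt_self _ hSpos.posSemidef.nonneg
  have hAps : A.PosSemidef := (CFC.sqrt_nonneg S).posSemidef
  have hAT : Aᵀ = A := by simpa using hAps.isHermitian.eq
  have hdet : A.det * A.det = S.det := by rw [← det_mul, hAA]
  have hA0 : A.det ≠ 0 := fun h => hSpos.det_pos.ne' (by rw [← hdet, h, zero_mul])
  have hAd : A.det = √S.det := by
    rw [← hdet, Real.sqrt_mul_self]
    exact hAps.det_nonneg
  have hdS : S.det = v ^ Fintype.card ι * R.det := by rw [hS, det_smul]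
  set T : EuclideanSpace ℝ ι → EuclideanSpace ℝ ι :=
    fun x => c + toEuclideanCLM (𝕜 := ℝ) A x with hT
  have hTm : Measurable T := by fun_prop
  have hvol : (volume : Measure (EuclideanSpace ℝ ι)).map T = ENNReal.ofReal (A.det)⁻¹ • volume := by
    have h1 : T = (fun x => c + x) ∘ (toEuclideanCLM (𝕜 := ℝ) A).toLinearMap := rfl
    have hd : LinearMap.det (toEuclideanCLM (𝕜 := ℝ) A).toLinearMap = A.det := by
      rw [coe_toEuclideanCLM_eq_toEuclideanLin, toEuclideanLin, toLpLin_eq_toLin, LinearMap.det_toLin]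
    rw [h1, ← Measure.map_map (by fun_prop) (by fun_prop),
      Measure.map_linearMap_addHaar_eq_smul_addHaar _ (by rw [hd]; exact hA0), Measure.map_smul,
      hd, abs_inv, abs_of_nonneg hAps.det_nonneg, map_add_left_eq_self]
  -- The factor det A cancels the Jacobian in `hvol`; with it, the pullback along `T` is exactly the
  -- standard density.
  have hdens : (fun y => ENNReal.ofReal (A.det * normalDensity R v c y)) ∘ T =
      fun x => ENNReal.ofReal (normalDensity (1 : Matrix ι ι ℝ) 1 0 x) := by
    funext x
    have hq : (T x - c).ofLp ⬝ᵥ R⁻¹ *ᵥ (T x - c).ofLp = v * (x.ofLp ⬝ᵥ x.ofLp) := by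
      have h1 : (T x - c).ofLp = A *ᵥ x.ofLp := by simp [hT]
      have h2 : A * R⁻¹ * A = v • 1 := by
        have h3 : R = v⁻¹ • (A * A) := by rw [hAA, hS, smul_smul, inv_mul_cancel₀ hv.ne', one_smul]
        have hAu : IsUnit A.det := isUnit_iff_ne_zero.2 hA0
        have h4 : R⁻¹ = v • (A⁻¹ * A⁻¹) := by
          refine inv_eq_right_inv ?_
          rw [h3, smul_mul_smul_comm, inv_mul_cancel₀ hv.ne', one_smul, mul_assoc,
            mul_nonsing_inv_cancel_left _ _ hAu, mul_nonsing_inv _ hAu]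
        rw [h4, mul_smul_comm, smul_mul_assoc, ← mul_assoc, mul_nonsing_inv _ hAu, one_mul,
          nonsing_inv_mul _ hAu]
      have h6 (y : ι → ℝ) : (A *ᵥ x.ofLp) ⬝ᵥ y = x.ofLp ⬝ᵥ (A *ᵥ y) := by
        rw [dotProduct_mulVec, ← mulVec_transpose, hAT]
      rw [h1, h6, mulVec_mulVec, mulVec_mulVec, h2, smul_mulVec, one_mulVec, dotProduct_smul,
        smul_eq_mul]
    simp only [Function.comp]
    congr 1
    unfold normalDensity
    rw [hq, hAd, hdS]
    have h3 : 0 < R.det := hR.det_pos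
    have h4 : (2 * Real.pi * v) ^ Fintype.card ι * R.det =
        (2 * Real.pi) ^ Fintype.card ι * (v ^ Fintype.card ι * R.det) := by ring
    have h5 : 0 < v ^ Fintype.card ι * R.det := by positivity
    rw [h4, Real.sqrt_mul (by positivity) (v ^ Fintype.card ι * R.det), mul_inv, ← mul_assoc,
      mul_left_comm, mul_inv_cancel₀ (Real.sqrt_pos.2 h5).ne']
    simp only [mul_one, det_one, sub_zero, inv_one, one_mulVec]
    rw [mul_comm 2 v, mul_div_mul_left _ _ hv.ne']
  change (stdGaussian (EuclideanSpace ℝ ι)).map T = _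
  have hm : Measurable fun y => ENNReal.ofReal (A.det * normalDensity R v c y) :=
    ((measurable_normalDensity R measurable_const measurable_const measurable_id).const_mul
      _).ennreal_ofReal
  rw [stdGaussian_eq_withDensity, ← hdens, map_withDensity_comp hTm hm, hvol,
    withDensity_smul_measure, ← withDensity_smul _ hm]
  congr 1
  funext y
  have : 0 < A.det := lt_of_le_of_ne hAps.det_nonneg hA0.symm
  simp only [Pi.smul_apply, smul_eq_mul]
  rw [← ENNReal.ofReal_mul (by positivity), inv_mul_cancel_left₀ hA0]

end Normal

/-! ### Finite-dimensional laws of a Gaussian process -/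

section GaussianVector

variable {ι : Type*} [Fintype ι] [DecidableEq ι] {T Ω : Type*} [MeasurableSpace Ω]

/-- A Gaussian law is determined by its mean and its covariance form, and the form by its values on
the standard basis. -/
theorem map_eq_multivariateGaussian {P : Measure Ω} {X : T → Ω → ℝ}
    (hX : IsGaussianProcess X P) (x : ι → T) {c : EuclideanSpace ℝ ι} {S : Matrix ι ι ℝ}
    (hS : S.PosSemidef) (hc : ∀ j, ∫ ω, X (x j) ω ∂P = c j)
    (hcov : ∀ j k, covariance (X (x j)) (X (x k)) P = S j k) :
    P.map (fun ω => (WithLp.toLp 2 fun j => X (x j) ω : EuclideanSpace ℝ ι)) =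
      multivariateGaussian c S := by
  let L : (↥(Finset.univ : Finset ι) → ℝ) →L[ℝ] EuclideanSpace ℝ ι :=
    (PiLp.continuousLinearEquiv 2 ℝ (fun _ : ι => ℝ)).symm.toContinuousLinearMap ∘L
      ContinuousLinearMap.pi fun j => ContinuousLinearMap.proj ⟨j, Finset.mem_univ j⟩
  have hY : HasGaussianLaw (fun ω => (WithLp.toLp 2 fun j => X (x j) ω : EuclideanSpace ℝ ι)) P :=
    ((hX.comp_right x).hasGaussianLaw Finset.univ).map L
  have := hY.isGaussian_map
  have hYm := hY.aemeasurable
  apply IsGaussian.ext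
  · rw [integral_id_multivariateGaussian']
    ext j
    rw [← hc j]
    rw [integral_map hYm (by fun_prop)]
    exact ((EuclideanSpace.proj (𝕜 := ℝ) j).integral_comp_comm hY.integrable).symm
  · rw [← ContinuousLinearMap.toBilinForm_inj]
    refine LinearMap.BilinForm.ext_basis (EuclideanSpace.basisFun ι ℝ).toBasis fun i j => ?_
    rw [ContinuousLinearMap.toBilinForm_apply, ContinuousLinearMap.toBilinForm_apply,
      covarianceBilin_apply_eq_cov, covariance_map]
    · have (i : ι) : (fun u => inner ℝ ((EuclideanSpace.basisFun ι ℝ).toBasis i) u) ∘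
          (fun ω => (WithLp.toLp 2 fun j => X (x j) ω : EuclideanSpace ℝ ι)) = X (x i) := by
        ext; simp [PiLp.inner_apply]
      simp_rw [this, hcov, covarianceBilin_multivariateGaussian hS]
      simp
    any_goals exact Measurable.aestronglyMeasurable (by fun_prop)
    · exact hYm
    · exact IsGaussian.memLp_two_id

end GaussianVector

/-! ### Bayes updates of product priors with product likelihoods -/

section BayesProduct

variable {α β : Type*} [MeasurableSpace α] [MeasurableSpace β]

/-- Moving the normalizing constant into the density makes the product formulas for densities
applicable to posteriors. -/
theorem IsBayesUpdate.post_eq {μ post : Measure α} {l : α → ℝ≥0} (hl : Measurable l)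
    (h : IsBayesUpdate μ l post) :
    post = μ.withDensity (fun a => (∫⁻ a, (l a : ℝ≥0∞) ∂μ)⁻¹ * (l a : ℝ≥0∞)) := by
  obtain ⟨-, -, -, rfl⟩ := h
  rw [← withDensity_smul _ hl.coe_nnreal_ennreal]
  rfl

theorem IsBayesUpdate.isProbabilityMeasure {μ post : Measure α} {l : α → ℝ≥0}
    (h : IsBayesUpdate μ l post) : IsProbabilityMeasure post := by
  obtain ⟨-, h0, h1, rfl⟩ := h
  constructor
  simp [ENNReal.inv_mul_cancel h0 h1]

theorem IsBayesUpdate.prod {μ post : Measure α} {ν post' : Measure β} [SigmaFinite μ]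
    [SigmaFinite ν] {l : α → ℝ≥0} {l' : β → ℝ≥0} (hl : Measurable l) (hl' : Measurable l')
    (h : IsBayesUpdate μ l post) (h' : IsBayesUpdate ν l' post') :
    IsBayesUpdate (μ.prod ν) (fun a => l a.1 * l' a.2) (post.prod post') := by
  have hmass : ∫⁻ a, ((l a.1 * l' a.2 : ℝ≥0) : ℝ≥0∞) ∂(μ.prod ν) =
      (∫⁻ a, (l a : ℝ≥0∞) ∂μ) * ∫⁻ a, (l' a : ℝ≥0∞) ∂ν := by
    simp only [ENNReal.coe_mul]
    exact lintegral_prod_mul hl.coe_nnreal_ennreal.aemeasurable hl'.coe_nnreal_ennreal.aemeasurable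
  have hp := h.isProbabilityMeasure
  have hp' := h'.isProbabilityMeasure
  have e := h.post_eq hl
  have e' := h'.post_eq hl'
  obtain ⟨-, h0, h1, -⟩ := h
  obtain ⟨-, h0', h1', -⟩ := h'
  refine ⟨by fun_prop, ?_, ?_, ?_⟩
  · rw [hmass]; exact mul_ne_zero h0 h0'
  · rw [hmass]; exact ENNReal.mul_ne_top h1 h1'
  · rw [hmass, ← withDensity_smul _ (by fun_prop)]
    rw [e] at hp ⊢
    rw [e'] at hp' ⊢
    rw [prod_withDensity (by fun_prop) (by fun_prop)]
    congr 1
    funext a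
    simp only [Pi.smul_apply, smul_eq_mul, ENNReal.coe_mul]
    rw [ENNReal.mul_inv (Or.inl h0) (Or.inl h1)]
    ring

theorem IsBayesUpdate.pi {ι : Type*} [Fintype ι] {α : ι → Type*} [∀ i, MeasurableSpace (α i)]
    {μ post : ∀ i, Measure (α i)} [∀ i, SigmaFinite (μ i)] {l : ∀ i, α i → ℝ≥0}
    (hl : ∀ i, Measurable (l i)) (h : ∀ i, IsBayesUpdate (μ i) (l i) (post i)) :
    IsBayesUpdate (Measure.pi μ) (fun a => ∏ i, l i (a i)) (Measure.pi post) := by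
  have hmass : ∫⁻ a, ((∏ i, l i (a i) : ℝ≥0) : ℝ≥0∞) ∂(Measure.pi μ) =
      ∏ i, ∫⁻ a, (l i a : ℝ≥0∞) ∂(μ i) := by
    simp only [ENNReal.ofNNReal_finsetProd]
    exact lintegral_fintype_prod_eq_prod μ fun i => (hl i).coe_nnreal_ennreal
  have hm : Measurable fun a : ∀ i, α i => ∏ i, l i (a i) :=
    Finset.measurable_prod _ fun i _ => (hl i).comp (measurable_pi_apply i)
  -- Normalized, each density defines a probability measure; this gives the σ-finiteness that
  -- `pi_withDensity` asks for.
  have hp (i) : SigmaFinite ((μ i).withDensity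
      (fun a => (∫⁻ a, (l i a : ℝ≥0∞) ∂(μ i))⁻¹ * (l i a : ℝ≥0∞))) := by
    have := (h i).isProbabilityMeasure
    rw [← (h i).post_eq (hl i)]
    infer_instance
  refine ⟨hm.aemeasurable, ?_, ?_, ?_⟩
  · rw [hmass]; exact Finset.prod_ne_zero_iff.2 fun i _ => (h i).2.1
  · rw [hmass]; exact ENNReal.prod_ne_top fun i _ => (h i).2.2.1
  · rw [hmass, ← withDensity_smul _ hm.coe_nnreal_ennreal,
      funext fun i => (h i).post_eq (hl i), pi_withDensity]
    · congr 1
      funext a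
      simp only [Pi.smul_apply, smul_eq_mul, ENNReal.ofNNReal_finsetProd, Finset.prod_mul_distrib]
      -- The inverse distributes over the product because no evidence vanishes, which excludes 0 ·
      -- ∞.
      rw [ENNReal.prod_inv_distrib]
      exact fun i _ j _ _ => Or.inl (h i).2.1
    · exact fun i => (hl i).coe_nnreal_ennreal.const_mul _

end BayesProduct

/-! ### The inverse gamma law and the Jeffreys prior -/

theorem invGamma_eq_restrict_withDensity (α Q : ℝ) :
    invGamma α Q = (volume.restrict (Set.Ioi 0)).withDensity (fun x => ENNReal.ofReal
      (Q ^ α / Real.Gamma α * (Real.exp (-(Q / x)) / x ^ (α + 1)))) := by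
  rw [invGamma, ← withDensity_indicator measurableSet_Ioi]
  congr 1
  funext x
  by_cases hx : 0 < x <;> simp [Set.indicator, hx]

/-- The substitution x ↦ 1/x, with Jacobian x⁻², carries the gamma density to the inverse gamma
density. -/
theorem isProbabilityMeasure_invGamma {α Q : ℝ} (hα : 0 < α) (hQ : 0 < Q) :
    IsProbabilityMeasure (invGamma α Q) := by
  constructor
  rw [invGamma_eq_restrict_withDensity, withDensity_apply _ MeasurableSet.univ,
    Measure.restrict_univ, ← lintegral_gammaPDF_eq_one hα hQ,
    ← lintegral_add_compl (gammaPDF α Q) (measurableSet_Ioi (a := (0 : ℝ))), Set.compl_Ioi]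
  have h0 : ∫⁻ x in Set.Iic 0, gammaPDF α Q x = 0 := by
    rw [setLIntegral_congr Iio_ae_eq_Iic.symm]
    exact lintegral_gammaPDF_of_nonpos le_rfl
  have him : (fun x : ℝ => x⁻¹) '' Set.Ioi 0 = Set.Ioi 0 := by
    refine Set.Subset.antisymm ?_ fun x (hx : 0 < x) => ⟨x⁻¹, inv_pos.2 hx, inv_inv x⟩
    rintro _ ⟨x, hx, rfl⟩
    exact inv_pos.2 (Set.mem_Ioi.1 hx)
  rw [h0, add_zero]
  conv_rhs => rw [← him]
  rw [lintegral_image_eq_lintegral_abs_deriv_mul measurableSet_Ioi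
    (f' := fun x => -(x ^ 2)⁻¹)
    (fun x (hx : 0 < x) => (hasDerivAt_inv hx.ne').hasDerivWithinAt) inv_injective.injOn]
  refine setLIntegral_congr_fun measurableSet_Ioi fun x (hx : 0 < x) => ?_
  have hxi : 0 ≤ x⁻¹ := by positivity
  rw [gammaPDF_of_nonneg hxi, ← ENNReal.ofReal_mul (abs_nonneg _)]
  congr 1
  rw [abs_neg, abs_of_nonneg (by positivity), ← div_eq_mul_inv Q x, Real.inv_rpow hx.le,
    Real.rpow_add_one hx.ne', Real.rpow_sub_one hx.ne']
  field_simp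

instance : SigmaFinite jeffreysVariance := by
  -- `ENNReal.ofReal` is by definition the coercion of `Real.toNNReal`, and a finite-valued density
  -- keeps a measure σ-finite.
  have : SigmaFinite ((volume.restrict (Set.Ioi (0 : ℝ))).withDensity
      (fun v => ((1 / v).toNNReal : ℝ≥0∞))) := inferInstance
  exact this

instance (κ : Type*) [Fintype κ] : SigmaFinite (jeffreysPrior κ) := by
  unfold jeffreysPrior; infer_instance

/-- The model and its densities are only available for positive variances; the prior ignores the
others. -/
theorem ae_pos_jeffreysVariance : ∀ᵐ v ∂jeffreysVariance, 0 < v :=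
  (withDensity_absolutelyContinuous _ _).ae_le (ae_restrict_mem measurableSet_Ioi)

theorem ae_pos_jeffreysPrior (κ : Type*) [Fintype κ] : ∀ᵐ a ∂jeffreysPrior κ, 0 < a.2 :=
  Measure.quasiMeasurePreserving_snd.ae ae_pos_jeffreysVariance

/-! ### Generalized least squares and factorization of the likelihood -/

section Square

/-- Injectivity of H bounds the number of columns by the number of rows; with equality H would be
onto and reach y. -/
theorem card_lt_card {ι κ : Type*} [Fintype ι] [Fintype κ] {H : Matrix ι κ ℝ}
    (hH : LinearIndependent ℝ H.col) {y : ι → ℝ}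
    (hy : ¬ ∃ b : κ → ℝ, y = H *ᵥ b) : Fintype.card κ < Fintype.card ι := by
  have hinj : Function.Injective H.mulVecLin := mulVec_injective_iff.2 hH
  have hle := LinearMap.finrank_le_finrank_of_injective hinj
  rw [Module.finrank_fintype_fun_eq_card, Module.finrank_fintype_fun_eq_card] at hle
  refine lt_of_le_of_ne hle fun h => hy ?_
  have hs := (LinearMap.injective_iff_surjective_of_finrank_eq_finrank (by simpa using h)).1 hinj
  obtain ⟨b, hb⟩ := hs y
  exact ⟨b, hb.symm⟩

theorem posDef_information {ι κ : Type*} [Fintype ι] [DecidableEq ι] [Fintype κ]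
    {H : Matrix ι κ ℝ} {R : Matrix ι ι ℝ} (hR : R.PosDef) (hH : LinearIndependent ℝ H.col) :
    (Hᵀ * R⁻¹ * H).PosDef := by
  have := hR.inv.conjTranspose_mul_mul_same (B := H) (mulVec_injective_iff.2 hH)
  simpa using this

variable {ι κ : Type*} [Fintype ι] [DecidableEq ι] [Fintype κ] [DecidableEq κ]
  {H : Matrix ι κ ℝ} {R : Matrix ι ι ℝ}

theorem posDef_coefCov (hR : R.PosDef) (hH : LinearIndependent ℝ H.col) :
    (coefCov H R).PosDef :=
  (posDef_information hR hH).inv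

/-- These are the normal equations that define the least squares estimate. -/
theorem residual_orthogonal (hR : R.PosDef) (hH : LinearIndependent ℝ H.col)
    (y : EuclideanSpace ℝ ι) :
    Hᵀ *ᵥ (R⁻¹ *ᵥ (y.ofLp - H *ᵥ (coefMean H R y).ofLp)) = 0 := by
  have hu : IsUnit (Hᵀ * R⁻¹ * H).det :=
    isUnit_iff_ne_zero.2 (posDef_information hR hH).det_pos.ne'
  rw [mulVec_mulVec, mulVec_sub, mulVec_mulVec, coefMean, mulVec_mulVec,
    Matrix.mul_assoc _ Hᵀ, mul_nonsing_inv_cancel_left _ _ hu, sub_self]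

/-- Completing the square. -/
theorem quadForm_eq (hR : R.PosDef) (hH : LinearIndependent ℝ H.col)
    (y : EuclideanSpace ℝ ι) (b : EuclideanSpace ℝ κ) :
    (y - WithLp.toLp 2 (H *ᵥ b.ofLp)).ofLp ⬝ᵥ R⁻¹ *ᵥ (y - WithLp.toLp 2 (H *ᵥ b.ofLp)).ofLp =
      residualForm H R y + (b - coefMean H R y).ofLp ⬝ᵥ
        (coefCov H R)⁻¹ *ᵥ (b - coefMean H R y).ofLp := by
  have hu : IsUnit (Hᵀ * R⁻¹ * H).det :=
    isUnit_iff_ne_zero.2 (posDef_information hR hH).det_pos.ne'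
  have hRT : (R⁻¹)ᵀ = R⁻¹ := by simpa using hR.inv.isHermitian.eq
  have horth := residual_orthogonal hR hH y
  rw [residualForm, coefCov, nonsing_inv_nonsing_inv _ hu]
  set c := (coefMean H R y).ofLp
  set w := y.ofLp - H *ᵥ c
  set u := (b - coefMean H R y).ofLp with hu
  have h1 : (y - WithLp.toLp 2 (H *ᵥ b.ofLp)).ofLp = w - H *ᵥ u := by
    simp only [w, hu, WithLp.ofLp_sub, mulVec_sub, c]
    abel
  have h2 (x : ι → ℝ) : (H *ᵥ u) ⬝ᵥ x = u ⬝ᵥ (Hᵀ *ᵥ x) := by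
    rw [mulVec_transpose, dotProduct_comm u, ← dotProduct_mulVec, dotProduct_comm]
  have h3 : w ⬝ᵥ R⁻¹ *ᵥ (H *ᵥ u) = (H *ᵥ u) ⬝ᵥ R⁻¹ *ᵥ w := by
    rw [dotProduct_mulVec, ← mulVec_transpose, hRT, dotProduct_comm]
  -- By symmetry of R⁻¹ both cross terms equal u · Hᵀ R⁻¹ w, which vanishes by the normal equations.
  rw [h1, mulVec_sub, sub_dotProduct, dotProduct_sub, dotProduct_sub, h3, h2, h2, horth,
    mulVec_mulVec, mulVec_mulVec]
  simp

/-- The factor of the likelihood which does not depend on the regression coefficients. -/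
def profileFactor (H : Matrix ι κ ℝ) (R : Matrix ι ι ℝ) (y : EuclideanSpace ℝ ι) (v : ℝ) : ℝ :=
  (√((2 * Real.pi * v) ^ Fintype.card ι * R.det))⁻¹ *
    √((2 * Real.pi * v) ^ Fintype.card κ * (coefCov H R).det) *
    Real.exp (-(residualForm H R y / (2 * v)))

theorem profileFactor_pos (hR : R.PosDef) (hH : LinearIndependent ℝ H.col)
    (y : EuclideanSpace ℝ ι) {v : ℝ} (hv : 0 < v) : 0 < profileFactor H R y v := by
  have := hR.det_pos
  have := (posDef_coefCov hR hH).det_pos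
  unfold profileFactor
  positivity

/-- After completing the square, the normalizing constant of the Gaussian in b is moved into
`profileFactor`, so the second factor has integral 1 over b. -/
theorem normalDensity_eq_profileFactor_mul (hR : R.PosDef) (hH : LinearIndependent ℝ H.col)
    (y : EuclideanSpace ℝ ι) (b : EuclideanSpace ℝ κ) {v : ℝ} (hv : 0 < v) :
    normalDensity R v (WithLp.toLp 2 (H *ᵥ b.ofLp)) y =
      profileFactor H R y v * normalDensity (coefCov H R) v (coefMean H R y) b := by
  have h := (posDef_coefCov hR hH).det_pos
  have h' : 0 < √((2 * Real.pi * v) ^ Fintype.card κ * (coefCov H R).det) := by positivity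
  unfold normalDensity profileFactor
  rw [quadForm_eq hR hH, add_div, neg_add, Real.exp_add]
  field_simp

theorem residualForm_pos (hR : R.PosDef) {y : EuclideanSpace ℝ ι}
    (hy : ¬ ∃ b : κ → ℝ, y.ofLp = H *ᵥ b) : 0 < residualForm H R y := by
  have := hR.inv.dotProduct_mulVec_pos (x := y.ofLp - H *ᵥ (coefMean H R y).ofLp)
    (fun h => hy ⟨_, sub_eq_zero.1 h⟩)
  simpa [residualForm] using this

/-- The total mass of the likelihood under the Jeffreys prior. -/
def evidence (H : Matrix ι κ ℝ) (R : Matrix ι ι ℝ) (y : EuclideanSpace ℝ ι) (α : ℝ) : ℝ :=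
  (2 * Real.pi) ^ (-α) * (√R.det)⁻¹ * √(coefCov H R).det *
    (Real.Gamma α / (residualForm H R y / 2) ^ α)

/-- Count of powers of v: the likelihood carries -n/2, integrating out b adds k/2, and the prior
contributes -1. The total is -(α + 1). -/
theorem profileFactor_eq (hR : R.PosDef) (hH : LinearIndependent ℝ H.col)
    {y : EuclideanSpace ℝ ι} (hy : ¬ ∃ b : κ → ℝ, y.ofLp = H *ᵥ b) {α : ℝ}
    (hα : α = ((Fintype.card ι : ℝ) - Fintype.card κ) / 2) {v : ℝ} (hv : 0 < v) :
    1 / v * profileFactor H R y v = evidence H R y α *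
      ((residualForm H R y / 2) ^ α / Real.Gamma α *
        (Real.exp (-(residualForm H R y / 2 / v)) / v ^ (α + 1))) := by
  have hQ := residualForm_pos hR hy
  have hα0 : 0 < α := by
    have : (Fintype.card κ : ℝ) < Fintype.card ι := by exact_mod_cast card_lt_card hH hy
    rw [hα]; linarith
  have hG := Real.Gamma_pos_of_pos hα0
  have hQα : 0 < (residualForm H R y / 2) ^ α := by positivity
  have hpv : 0 < 2 * Real.pi * v := by positivity
  have hs (k : ℕ) : √((2 * Real.pi * v) ^ k) = (2 * Real.pi * v) ^ ((k : ℝ) / 2) := by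
    rw [Real.sqrt_eq_rpow, ← Real.rpow_natCast, ← Real.rpow_mul hpv.le]; ring_nf
  have hpow : ((2 * Real.pi * v) ^ ((Fintype.card ι : ℝ) / 2))⁻¹ *
      (2 * Real.pi * v) ^ ((Fintype.card κ : ℝ) / 2) = (2 * Real.pi) ^ (-α) * (v ^ α)⁻¹ := by
    rw [← Real.rpow_neg hpv.le, ← Real.rpow_add hpv, ← Real.rpow_neg hv.le,
      ← Real.mul_rpow (by positivity) hv.le, hα]
    ring_nf
  unfold profileFactor evidence
  rw [Real.sqrt_mul (by positivity), Real.sqrt_mul (by positivity), hs, hs, Real.rpow_add_one hv.ne',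
    div_div (residualForm H R y)]
  have hvα : 0 < v ^ α := by positivity
  calc _ = 1 / v * ((((2 * Real.pi * v) ^ ((Fintype.card ι : ℝ) / 2))⁻¹ *
      (2 * Real.pi * v) ^ ((Fintype.card κ : ℝ) / 2)) * (√R.det)⁻¹ * √(coefCov H R).det *
      Real.exp (-(residualForm H R y / (2 * v)))) := by rw [mul_inv]; ring
    _ = _ := by rw [hpow]; field_simp

theorem evidence_pos (hR : R.PosDef) (hH : LinearIndependent ℝ H.col)
    {y : EuclideanSpace ℝ ι} (hy : ¬ ∃ b : κ → ℝ, y.ofLp = H *ᵥ b) {α : ℝ} (hα : 0 < α) :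
    0 < evidence H R y α := by
  have := residualForm_pos hR hy
  have := Real.Gamma_pos_of_pos hα
  have := hR.det_pos
  have := (posDef_coefCov hR hH).det_pos
  unfold evidence
  positivity

end Square

/-! ### Posterior of a single kriging model -/

section Posterior

variable {ι κ : Type*} [Fintype ι] [DecidableEq ι] [Fintype κ] [DecidableEq κ]
  {H : Matrix ι κ ℝ} {R : Matrix ι ι ℝ}

/-- The density at `y` of `N(H b, v R)`, as a function of `(b, v)`. -/
def krigingLik (H : Matrix ι κ ℝ) (R : Matrix ι ι ℝ) (y : EuclideanSpace ℝ ι)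
    (a : EuclideanSpace ℝ κ × ℝ) : ℝ≥0 :=
  (normalDensity R a.2 (WithLp.toLp 2 (H *ᵥ a.1.ofLp)) y).toNNReal

theorem measurable_krigingLik {ι κ : Type*} [Fintype ι] [DecidableEq ι] [Fintype κ]
    (H : Matrix ι κ ℝ) (R : Matrix ι ι ℝ) (y : EuclideanSpace ℝ ι) :
    Measurable (krigingLik H R y) := by
  unfold krigingLik
  have : Continuous fun a : EuclideanSpace ℝ κ × ℝ =>
    (WithLp.toLp 2 (H *ᵥ a.1.ofLp) : EuclideanSpace ℝ ι) := by fun_prop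
  exact (measurable_normalDensity R measurable_snd this.measurable measurable_const).real_toNNReal

theorem coe_krigingLik (hR : R.PosDef) (hH : LinearIndependent ℝ H.col)
    (y : EuclideanSpace ℝ ι) (b : EuclideanSpace ℝ κ) {v : ℝ} (hv : 0 < v) :
    (krigingLik H R y (b, v) : ℝ≥0∞) = ENNReal.ofReal (profileFactor H R y v) *
      ENNReal.ofReal (normalDensity (coefCov H R) v (coefMean H R y) b) := by
  rw [← ENNReal.ofReal_mul (profileFactor_pos hR hH y hv).le,
    ← normalDensity_eq_profileFactor_mul hR hH y b hv]
  rfl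

theorem setLIntegral_krigingLik_coef (hR : R.PosDef) (hH : LinearIndependent ℝ H.col)
    (y : EuclideanSpace ℝ ι) {v : ℝ} (hv : 0 < v) {A : Set (EuclideanSpace ℝ κ)}
    (hA : MeasurableSet A) :
    ∫⁻ b in A, (krigingLik H R y (b, v) : ℝ≥0∞) = ENNReal.ofReal (profileFactor H R y v) *
      multivariateGaussian (coefMean H R y) (v • coefCov H R) A := by
  rw [multivariateGaussian_eq_withDensity (posDef_coefCov hR hH) hv, withDensity_apply _ hA]
  simp_rw [coe_krigingLik hR hH y _ hv]
  exact lintegral_const_mul' _ _ ENNReal.ofReal_ne_top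

/-- Posterior of the regression coefficients for a known variance. -/
theorem isBayesUpdate_coef (hR : R.PosDef) (hH : LinearIndependent ℝ H.col)
    (y : EuclideanSpace ℝ ι) {v : ℝ} (hv : 0 < v) :
    IsBayesUpdate volume (fun b => krigingLik H R y (b, v))
      (multivariateGaussian (coefMean H R y) (v • coefCov H R)) := by
  have hm : Measurable fun b : EuclideanSpace ℝ κ => krigingLik H R y (b, v) :=
    (measurable_krigingLik H R y).comp (measurable_id.prodMk measurable_const)
  have hmass : ∫⁻ b : EuclideanSpace ℝ κ, (krigingLik H R y (b, v) : ℝ≥0∞) =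
      ENNReal.ofReal (profileFactor H R y v) := by
    rw [← setLIntegral_univ, setLIntegral_krigingLik_coef hR hH y hv MeasurableSet.univ,
      measure_univ, mul_one]
  have h0 : ENNReal.ofReal (profileFactor H R y v) ≠ 0 := by
    simpa using profileFactor_pos hR hH y hv
  refine ⟨hm.aemeasurable, hmass ▸ h0, hmass ▸ ENNReal.ofReal_ne_top, ?_⟩
  ext A hA
  rw [hmass, Measure.smul_apply, withDensity_apply _ hA, setLIntegral_krigingLik_coef hR hH y hv hA,
    smul_eq_mul, ← mul_assoc, ENNReal.inv_mul_cancel h0 ENNReal.ofReal_ne_top, one_mul]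

/-- Tonelli with b inside and v outside: for each v the inner integral is `profileFactor` times the
Gaussian mass of A, and 1/v times `profileFactor` is the evidence times the inverse gamma density.
-/
theorem setLIntegral_krigingLik (hR : R.PosDef) (hH : LinearIndependent ℝ H.col)
    {y : EuclideanSpace ℝ ι} (hy : ¬ ∃ b : κ → ℝ, y.ofLp = H *ᵥ b) {α : ℝ}
    (hα : α = ((Fintype.card ι : ℝ) - Fintype.card κ) / 2) (hα0 : 0 < α)
    {A : Set (EuclideanSpace ℝ κ)} (hA : MeasurableSet A) {B : Set ℝ} (hB : MeasurableSet B) :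
    ∫⁻ a in A ×ˢ B, (krigingLik H R y a : ℝ≥0∞) ∂(jeffreysPrior κ) =
      ENNReal.ofReal (evidence H R y α) *
        ∫⁻ v in B, multivariateGaussian (coefMean H R y) (v • coefCov H R) A
          ∂(invGamma α (residualForm H R y / 2)) := by
  have he := evidence_pos hR hH hy hα0
  have hf := (measurable_krigingLik H R y).coe_nnreal_ennreal
  rw [jeffreysPrior, ← Measure.prod_restrict, lintegral_prod_symm' _ hf,
    invGamma_eq_restrict_withDensity, jeffreysVariance]
  -- Since the densities are finite, this needs no measurability in v of the Gaussian mass of A.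
  rw [setLIntegral_withDensity_eq_setLIntegral_mul_non_measurable _
      (f := fun v => ENNReal.ofReal (1 / v)) (by fun_prop) _ hB,
    setLIntegral_withDensity_eq_setLIntegral_mul_non_measurable _
      (f := fun v => ENNReal.ofReal ((residualForm H R y / 2) ^ α / Real.Gamma α *
        (Real.exp (-(residualForm H R y / 2 / v)) / v ^ (α + 1)))) (by fun_prop) _ hB,
    ← lintegral_const_mul' _ _ ENNReal.ofReal_ne_top, Measure.restrict_restrict hB]
  · refine setLIntegral_congr_fun (hB.inter measurableSet_Ioi) fun v ⟨_, (hv : 0 < v)⟩ => ?_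
    simp only [Pi.mul_apply]
    rw [setLIntegral_krigingLik_coef hR hH y hv hA, ← mul_assoc, ← mul_assoc,
      ← ENNReal.ofReal_mul (by positivity), ← ENNReal.ofReal_mul he.le,
      profileFactor_eq hR hH hy hα hv]
  · exact ae_of_all _ fun _ => ENNReal.ofReal_lt_top
  · exact ae_of_all _ fun _ => ENNReal.ofReal_lt_top

/-- Joint posterior of the regression coefficients and the variance under the Jeffreys prior. -/
theorem exists_isBayesUpdate_isGaussianInvGamma (hR : R.PosDef) (hH : LinearIndependent ℝ H.col)
    {y : EuclideanSpace ℝ ι} (hy : ¬ ∃ b : κ → ℝ, y.ofLp = H *ᵥ b) {α : ℝ}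
    (hα : α = ((Fintype.card ι : ℝ) - Fintype.card κ) / 2) :
    ∃ post : Measure (EuclideanSpace ℝ κ × ℝ),
      IsBayesUpdate (jeffreysPrior κ) (krigingLik H R y) post ∧
      IsGaussianInvGamma H R y α post := by
  have hα0 : 0 < α := by
    have : (Fintype.card κ : ℝ) < Fintype.card ι := by exact_mod_cast card_lt_card hH hy
    rw [hα]; linarith
  have hprob := isProbabilityMeasure_invGamma hα0 (half_pos (residualForm_pos (H := H) hR hy))
  have hmass : ∫⁻ a, (krigingLik H R y a : ℝ≥0∞) ∂(jeffreysPrior κ) =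
      ENNReal.ofReal (evidence H R y α) := by
    rw [← setLIntegral_univ, ← Set.univ_prod_univ,
      setLIntegral_krigingLik hR hH hy hα hα0 MeasurableSet.univ MeasurableSet.univ]
    simp
  have h0 : ENNReal.ofReal (evidence H R y α) ≠ 0 := by
    simpa using evidence_pos hR hH hy hα0
  have hpost : IsBayesUpdate (jeffreysPrior κ) (krigingLik H R y)
      ((∫⁻ a, (krigingLik H R y a : ℝ≥0∞) ∂(jeffreysPrior κ))⁻¹ •
        (jeffreysPrior κ).withDensity fun a => (krigingLik H R y a : ℝ≥0∞)) :=
    ⟨(measurable_krigingLik H R y).aemeasurable, hmass ▸ h0, hmass ▸ ENNReal.ofReal_ne_top, rfl⟩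
  refine ⟨_, hpost, ?_⟩
  have hrect (A : Set (EuclideanSpace ℝ κ)) (B : Set ℝ) (hA : MeasurableSet A)
      (hB : MeasurableSet B) : ((∫⁻ a, (krigingLik H R y a : ℝ≥0∞) ∂(jeffreysPrior κ))⁻¹ •
        (jeffreysPrior κ).withDensity fun a => (krigingLik H R y a : ℝ≥0∞)) (A ×ˢ B) =
      ∫⁻ v in B, multivariateGaussian (coefMean H R y) (v • coefCov H R) A
        ∂(invGamma α (residualForm H R y / 2)) := by
    rw [hmass, Measure.smul_apply, withDensity_apply _ (hA.prod hB),
      setLIntegral_krigingLik hR hH hy hα hα0 hA hB, smul_eq_mul, ← mul_assoc,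
      ENNReal.inv_mul_cancel h0 ENNReal.ofReal_ne_top, one_mul]
  refine ⟨hpost.isProbabilityMeasure, ?_, hrect⟩
  ext B hB
  -- The variance marginal is the case A = univ, where the Gaussian mass is 1.
  rw [Measure.map_apply measurable_snd hB, ← Set.univ_prod, hrect _ _ MeasurableSet.univ hB]
  simp

end Posterior

/-! ### Joint density of a chain driven by independent innovations -/

section Chain

variable {Ω : Type*} [MeasurableSpace Ω] {P : Measure Ω}

/-- By independence (X, W) has density g(w) with respect to law(X) ⊗ μ. The shear (x, w) ↦ (x, T x +
w) preserves this reference measure, as μ is translation invariant, and replaces w by y - T x. -/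
theorem map_prodMk_add_eq_withDensity {E G : Type*} [MeasurableSpace E] [AddCommGroup G]
    [MeasurableSpace G] [MeasurableAdd₂ G] [MeasurableSub₂ G] {μ : Measure G} [SigmaFinite μ]
    [μ.IsAddLeftInvariant] [IsProbabilityMeasure P] {X : Ω → E} {W : Ω → G} (hX : Measurable X)
    (hW : Measurable W) (hind : IndepFun X W P) {g : G → ℝ≥0∞} (hg : Measurable g)
    (hlaw : P.map W = μ.withDensity g) {T : E → G} (hT : Measurable T) :
    P.map (fun ω => (X ω, T (X ω) + W ω)) =
      ((P.map X).prod μ).withDensity (fun b => g (b.2 - T b.1)) := by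
  have hs : MeasurePreserving (fun b : E × G => (b.1, T b.1 + b.2)) ((P.map X).prod μ)
      ((P.map X).prod μ) :=
    (MeasurePreserving.id _).skew_product (g := fun a w => T a + w)
      ((hT.comp measurable_fst).add measurable_snd)
      (ae_of_all _ fun a => map_add_left_eq_self μ (T a))
  have hG : Measurable fun b : E × G => g (b.2 - T b.1) :=
    hg.comp (measurable_snd.sub (hT.comp measurable_fst))
  have := Measure.isProbabilityMeasure_map (μ := P) hX.aemeasurable
  have hcomp : (fun b : E × G => g b.2) = (fun b : E × G => g (b.2 - T b.1)) ∘
      fun b : E × G => (b.1, T b.1 + b.2) := by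
    funext b; simp
  calc P.map (fun ω => (X ω, T (X ω) + W ω))
      = (P.map fun ω => (X ω, W ω)).map fun b : E × G => (b.1, T b.1 + b.2) := by
        rw [Measure.map_map hs.measurable (hX.prodMk hW)]; rfl
    _ = _ := by
        rw [(indepFun_iff_map_prod_eq_prod_map_map hX.aemeasurable hW.aemeasurable).1 hind, hlaw,
          prod_withDensity_right hg, hcomp, map_withDensity_comp hs.measurable hG, hs.map_eq]

theorem measurable_snoc {n : ℕ} {E : Fin (n + 1) → Type*} [∀ i, MeasurableSpace (E i)] :
    Measurable fun a : (∀ i : Fin n, E i.castSucc) × E (Fin.last n) =>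
      (Fin.snoc a.1 a.2 : ∀ i, E i) := by
  refine measurable_pi_lambda _ fun i => ?_
  induction i using Fin.lastCases with
  | last => simpa using measurable_snd
  | cast i =>
    simp only [Fin.snoc_castSucc]
    exact (measurable_pi_apply i).comp measurable_fst

theorem measurePreserving_init_last {n : ℕ} {E : Fin (n + 1) → Type*} [∀ i, MeasurableSpace (E i)]
    (μ : ∀ i, Measure (E i)) [∀ i, SigmaFinite (μ i)] :
    MeasurePreserving (fun y : ∀ i, E i => (Fin.init y, y (Fin.last n))) (Measure.pi μ)
      ((Measure.pi fun i : Fin n => μ i.castSucc).prod (μ (Fin.last n))) := by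
  have he : Measurable fun y : ∀ i, E i => (Fin.init y, y (Fin.last n)) :=
    (measurable_pi_lambda _ fun i => measurable_pi_apply i.castSucc).prodMk
      (measurable_pi_apply _)
  let s : (∀ i : Fin n, E i.castSucc) × E (Fin.last n) → ∀ i, E i := fun a => Fin.snoc a.1 a.2
  have hs : Measurable s := measurable_snoc
  refine ⟨he, ?_⟩
  have hpi : Measure.pi μ =
      ((Measure.pi fun i : Fin n => μ i.castSucc).prod (μ (Fin.last n))).map s := by
    refine Measure.pi_eq fun B hB => ?_
    have : s ⁻¹' (Set.univ.pi B) =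
        (Set.univ.pi fun i : Fin n => B i.castSucc) ×ˢ B (Fin.last n) := by
      ext a
      simp [s, Set.mem_pi, Fin.forall_fin_succ']
    rw [Measure.map_apply hs (MeasurableSet.univ_pi hB), this, Measure.prod_prod, Measure.pi_pi,
      Fin.prod_univ_castSucc]
  have hes : (fun y : ∀ i, E i => (Fin.init y, y (Fin.last n))) ∘ s = id := by
    funext a
    simp [s]
  rw [hpi, Measure.map_map he hs, hes, Measure.map_id]

/-- Induction on the length, splitting off the last level: its innovation is independent of all
earlier levels jointly, so its conditional density given them is g(y - T(·)), which depends on the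
preceding level only. -/
theorem map_chain_eq_withDensity [IsProbabilityMeasure P] {m : ℕ} {E : Fin (m + 1) → Type*}
    [∀ t, AddCommGroup (E t)] [∀ t, MeasurableSpace (E t)] [∀ t, MeasurableAdd₂ (E t)]
    [∀ t, MeasurableSub₂ (E t)] (μ : ∀ t, Measure (E t)) [∀ t, SigmaFinite (μ t)]
    [∀ t, (μ t).IsAddLeftInvariant] {Y : ∀ t, Ω → E t} (hY : ∀ t, Measurable (Y t))
    {W : ∀ i : Fin m, Ω → E i.succ} (hW : ∀ i, Measurable (W i))
    {T : ∀ i : Fin m, E i.castSucc → E i.succ} (hT : ∀ i, Measurable (T i))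
    (hYW : ∀ i ω, Y i.succ ω = T i (Y i.castSucc ω) + W i ω)
    (hind : ∀ i, IndepFun (W i) (fun ω (t : {t : Fin (m + 1) // t ≤ i.castSucc}) => Y t ω) P)
    {g₀ : E 0 → ℝ≥0∞} (hg₀ : Measurable g₀) (h₀ : P.map (Y 0) = (μ 0).withDensity g₀)
    {g : ∀ i : Fin m, E i.succ → ℝ≥0∞} (hg : ∀ i, Measurable (g i))
    (hlaw : ∀ i, P.map (W i) = (μ i.succ).withDensity (g i)) :
    P.map (fun ω t => Y t ω) = (Measure.pi μ).withDensity
      (fun y => g₀ (y 0) * ∏ i : Fin m, g i (y i.succ - T i (y i.castSucc))) := by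
  induction m with
  | zero =>
    -- The default element is `0`, so `piUnique` is evaluation at `0`.
    let _ : Unique (Fin (0 + 1)) := ⟨⟨0⟩, fun a => Fin.ext (by omega)⟩
    have hm := (measurePreserving_piUnique μ).symm
    have h1 : (fun ω t => Y t ω) = (MeasurableEquiv.piUnique E).symm ∘ Y 0 := by
      funext ω
      exact ((MeasurableEquiv.piUnique E).symm_apply_apply fun t => Y t ω).symm
    have h2 : g₀ = (fun y : ∀ t, E t => g₀ (y 0)) ∘ (MeasurableEquiv.piUnique E).symm := by
      funext a
      exact congrArg g₀ ((MeasurableEquiv.piUnique E).apply_symm_apply a).symm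
    simp only [Finset.univ_eq_empty, Finset.prod_empty, mul_one]
    rw [h1, ← Measure.map_map hm.measurable (hY 0), h₀]
    conv_lhs => rw [h2]
    refine (map_withDensity_comp (μ := μ 0) hm.measurable
      (hg₀.comp (measurable_pi_apply 0))).trans ?_
    exact congrArg (fun ν => Measure.withDensity ν _) hm.map_eq
  | succ m ih =>
    have hinit : Measurable fun ω (t : Fin (m + 1)) => Y t.castSucc ω :=
      measurable_pi_lambda _ fun t => hY t.castSucc
    have hX := ih (E := fun t => E t.castSucc) (fun t => μ t.castSucc)
      (Y := fun t => Y t.castSucc) (fun t => hY t.castSucc)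
      (W := fun i => W i.castSucc) (fun i => hW i.castSucc)
      (T := fun i => T i.castSucc) (fun i => hT i.castSucc) (fun i => hYW i.castSucc)
      (fun i => by
        refine (hind i.castSucc).comp measurable_id
          (ψ := fun w (t : {t : Fin (m + 1) // t ≤ i.castSucc}) =>
            w ⟨t.1.castSucc, Fin.castSucc_le_castSucc_iff.2 t.2⟩) ?_
        exact measurable_pi_lambda _ fun t => measurable_pi_apply _)
      hg₀ h₀ (g := fun i => g i.castSucc) (fun i => hg i.castSucc) (fun i => hlaw i.castSucc)
    have hind' : IndepFun (fun ω (t : Fin (m + 1)) => Y t.castSucc ω) (W (Fin.last m)) P := by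
      refine ((hind (Fin.last m)).comp measurable_id
          (ψ := fun w (t : Fin (m + 1)) =>
            w ⟨t.castSucc, Fin.castSucc_le_castSucc_iff.2 (Fin.le_last t)⟩) ?_).symm
      exact measurable_pi_lambda _ fun t => measurable_pi_apply _
    have hlast := map_prodMk_add_eq_withDensity (μ := μ (Fin.last (m + 1))) hinit
      (hW (Fin.last m)) hind' (hg (Fin.last m)) (hlaw (Fin.last m))
      (T := fun a => T (Fin.last m) (a (Fin.last m)))
      ((hT (Fin.last m)).comp (measurable_pi_apply _))
    -- `i.castSucc.succ` and `i.succ.castSucc` agree definitionally; the ascription fixes the second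
    -- form, the one of the shortened chain.
    let Tm : ∀ i : Fin m, E i.castSucc.castSucc → E i.succ.castSucc := fun i => T i.castSucc
    let gm : ∀ i : Fin m, E i.succ.castSucc → ℝ≥0∞ := fun i => g i.castSucc
    have hTm (i) : Measurable (Tm i) := hT i.castSucc
    have hgm (i) : Measurable (gm i) := hg i.castSucc
    set G : (∀ t : Fin (m + 1), E t.castSucc) → ℝ≥0∞ := fun y => g₀ (y 0) *
      ∏ i : Fin m, gm i (y i.succ - Tm i (y i.castSucc))
    have hGm : Measurable G :=
      (hg₀.comp (measurable_pi_apply (0 : Fin (m + 1)))).mul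
        (Finset.measurable_prod _ fun i _ => (hgm i).comp
          ((measurable_pi_apply i.succ).sub ((hTm i).comp (measurable_pi_apply i.castSucc))))
    let Tl : E (Fin.last m).castSucc → E (Fin.last (m + 1)) := T (Fin.last m)
    have hTl : Measurable Tl := hT (Fin.last m)
    set g' : (∀ t : Fin (m + 1), E t.castSucc) × E (Fin.last (m + 1)) → ℝ≥0∞ :=
      fun b => g (Fin.last m) (b.2 - Tl (b.1 (Fin.last m)))
    have hgl : Measurable g' :=
      (hg (Fin.last m)).comp (measurable_snd.sub
        (hTl.comp ((measurable_pi_apply (Fin.last m)).comp measurable_fst)))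
    have hGg : Measurable fun b : (∀ t : Fin (m + 1), E t.castSucc) × E (Fin.last (m + 1)) =>
        G b.1 * g' b := (hGm.comp measurable_fst).mul hgl
    have he := measurePreserving_init_last μ
    have hYm : Measurable fun ω t => Y t ω := measurable_pi_lambda _ hY
    have hkey : (P.map fun ω t => Y t ω).map (fun y => (Fin.init y, y (Fin.last (m + 1)))) =
        ((Measure.pi μ).withDensity (fun y => g₀ (y 0) *
          ∏ i : Fin (m + 1), g i (y i.succ - T i (y i.castSucc)))).map
            (fun y => (Fin.init y, y (Fin.last (m + 1)))) := by
      have hD : (fun y : ∀ t, E t => g₀ (y 0) *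
          ∏ i : Fin (m + 1), g i (y i.succ - T i (y i.castSucc))) =
          (fun b => G b.1 * g' b) ∘ fun y => (Fin.init y, y (Fin.last (m + 1))) := by
        funext y
        rw [Fin.prod_univ_castSucc, ← mul_assoc]
        rfl
      have hYl : (fun y : ∀ t, E t => (Fin.init y, y (Fin.last (m + 1)))) ∘ (fun ω t => Y t ω) =
          fun ω => ((fun t : Fin (m + 1) => Y t.castSucc ω),
            T (Fin.last m) (Y (Fin.last m).castSucc ω) + W (Fin.last m) ω) := by
        funext ω
        exact Prod.ext rfl (hYW (Fin.last m) ω)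
      rw [Measure.map_map he.measurable hYm, hYl, hD,
        map_withDensity_comp he.measurable hGg, he.map_eq]
      refine hlast.trans ?_
      rw [hX, prod_withDensity_left hGm]
      exact (withDensity_mul _ (hGm.comp measurable_fst) hgl).symm
    -- `Fin.snoc` inverts the splitting, so equality of the image measures in `hkey` gives equality
    -- of the measures.
    have hse : (fun a : (∀ t : Fin (m + 1), E t.castSucc) × E (Fin.last (m + 1)) =>
        (Fin.snoc a.1 a.2 : ∀ t, E t)) ∘
        (fun y : ∀ t, E t => (Fin.init y, y (Fin.last (m + 1)))) = id := by
      funext y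
      simp
    have h := congrArg (Measure.map fun a : (∀ t : Fin (m + 1), E t.castSucc) ×
      E (Fin.last (m + 1)) => (Fin.snoc a.1 a.2 : ∀ t, E t)) hkey
    rwa [Measure.map_map measurable_snoc he.measurable, Measure.map_map measurable_snoc
      he.measurable, hse, Measure.map_id, Measure.map_id] at h

end Chain

/-! ### Laws of the observations in the autoregressive model -/

theorem coDesign_mulVec {n a b : ℕ} (Fρ : Matrix (Fin n) (Fin a) ℝ) (w : Fin n → ℝ)
    (F : Matrix (Fin n) (Fin b) ℝ) (c : Fin a ⊕ Fin b → ℝ) (j : Fin n) :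
    (coDesign Fρ w F *ᵥ c) j =
      (∑ k, Fρ j k * c (Sum.inl k)) * w j + (F *ᵥ fun k => c (Sum.inr k)) j := by
  rw [coDesign, fromCols_mulVec]
  simp only [Pi.add_apply, mulVec, dotProduct, Function.comp, of_apply, Finset.sum_mul]
  congr 1
  exact Finset.sum_congr rfl fun k _ => by ring

theorem normalDensity_sub {ι : Type*} [Fintype ι] [DecidableEq ι] (R : Matrix ι ι ℝ) (v : ℝ)
    (c y a : EuclideanSpace ℝ ι) :
    normalDensity R v c (y - a) = normalDensity R v (a + c) y := by
  simp only [normalDensity, sub_sub]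

theorem continuous_krigingLik_coDesign {X : Type*} [TopologicalSpace X] {n a b : ℕ}
    (Fρ : Matrix (Fin n) (Fin a) ℝ) (F : Matrix (Fin n) (Fin b) ℝ) (R : Matrix (Fin n) (Fin n) ℝ)
    (c : EuclideanSpace ℝ (Fin a ⊕ Fin b) × ℝ) {w : X → Fin n → ℝ}
    {y : X → EuclideanSpace ℝ (Fin n)} (hw : Continuous w) (hy : Continuous y) :
    Continuous fun t => krigingLik (coDesign Fρ (w t) F) R (y t) c := by
  have hc : Continuous fun t => (coDesign Fρ (w t) F *ᵥ c.1.ofLp) := by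
    refine continuous_pi fun j => ?_
    simp only [coDesign_mulVec]
    fun_prop
  exact continuous_real_toNNReal.comp
    (continuous_normalDensity R c.2 ((PiLp.continuous_toLp 2 _).comp hc) hy)

section Model

variable {m d : ℕ} {p : Fin (m + 1) → ℕ} {q : Fin m → ℕ} {D : Set (EuclideanSpace ℝ (Fin d))}
  {Ω : Type*} [MeasurableSpace Ω] {f : (t : Fin (m + 1)) → D → Fin (p t) → ℝ}
  {fρ : (i : Fin m) → D → Fin (q i) → ℝ} {r : Fin (m + 1) → EuclideanSpace ℝ (Fin d) → ℝ}
  {Z : Fin (m + 1) → D → Ω → ℝ} {ψ : Params p q} {P : Measure Ω}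

theorem measurable_obs {n : ℕ} {Zt : D → Ω → ℝ} (hZ : ∀ u, Measurable (Zt u)) (x : Fin n → D) :
    Measurable (obs Zt x) := by
  have : Measurable fun ω j => Zt (x j) ω := measurable_pi_lambda _ fun j => hZ (x j)
  exact (WithLp.measurable_toLp 2 _).comp this

theorem IsARModel.measurable_discrepancy (h : IsARModel f fρ r Z ψ P) (i : Fin m) (u : D) :
    Measurable (discrepancy fρ Z ψ i u) :=
  (h.measurable i.succ u).sub ((h.measurable i.castSucc u).const_mul _)

theorem IsARModel.map_obs_zero (h : IsARModel f fρ r Z ψ P) {n : ℕ} {x : Fin n → D}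
    (hR : (corrMatrix (r 0) x).PosDef) (hv : 0 < ψ.1.2) :
    P.map (obs (Z 0) x) = volume.withDensity fun y =>
      ENNReal.ofReal (normalDensity (corrMatrix (r 0) x) ψ.1.2
        (WithLp.toLp 2 (regMatrix (f 0) x *ᵥ ψ.1.1.ofLp)) y) := by
  rw [← multivariateGaussian_eq_withDensity hR hv]
  refine map_eq_multivariateGaussian h.first_gaussian x (hR.smul hv).posSemidef
    (fun j => h.first_mean (x j)) fun j k => ?_
  rw [h.first_cov]
  rfl

theorem IsARModel.map_obs_discrepancy (h : IsARModel f fρ r Z ψ P) (i : Fin m) {n : ℕ}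
    {x : Fin n → D} (hR : (corrMatrix (r i.succ) x).PosDef) (hv : 0 < (ψ.2 i).2) :
    P.map (obs (discrepancy fρ Z ψ i) x) = volume.withDensity fun y =>
      ENNReal.ofReal (normalDensity (corrMatrix (r i.succ) x) (ψ.2 i).2
        (WithLp.toLp 2 (regMatrix (f i.succ) x *ᵥ fun k => (ψ.2 i).1 (Sum.inr k))) y) := by
  rw [← multivariateGaussian_eq_withDensity hR hv]
  refine map_eq_multivariateGaussian (h.disc_gaussian i) x (hR.smul hv).posSemidef
    (fun j => h.disc_mean i (x j)) fun j k => ?_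
  rw [h.disc_cov]
  rfl

/-- The vector `ρ(x) ⊙ w`, where `w` is restricted to the nested design by `e`. -/
def scaledRestrict {n n' : ℕ} (fρ : (i : Fin m) → D → Fin (q i) → ℝ) (ψ : Params p q) (i : Fin m)
    (x : Fin n → D) (e : Fin n → Fin n') (w : EuclideanSpace ℝ (Fin n')) :
    EuclideanSpace ℝ (Fin n) :=
  WithLp.toLp 2 fun j => scale fρ ψ i (x j) * w (e j)

theorem measurable_scaledRestrict {n n' : ℕ} (fρ : (i : Fin m) → D → Fin (q i) → ℝ)
    (ψ : Params p q) (i : Fin m) (x : Fin n → D) (e : Fin n → Fin n') :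
    Measurable (scaledRestrict fρ ψ i x e) := by
  unfold scaledRestrict
  fun_prop

/-- Nestedness of the designs is used here: level t on D_t is a function of the observed vector of
level t-1, plus the discrepancy. -/
theorem obs_succ_eq {Ω : Type*} (fρ : (i : Fin m) → D → Fin (q i) → ℝ) (Z : Fin (m + 1) → D → Ω → ℝ)
    (ψ : Params p q) (i : Fin m) {n n' : ℕ} {x : Fin n → D} {x' : Fin n' → D}
    {e : Fin n → Fin n'} (he : ∀ j, x j = x' (e j)) (ω : Ω) :
    obs (Z i.succ) x ω = scaledRestrict fρ ψ i x e (obs (Z i.castSucc) x' ω) +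
      obs (discrepancy fρ Z ψ i) x ω := by
  ext j
  simp [obs, scaledRestrict, discrepancy, he]

/-- Shifting the argument by ρ ⊙ w amounts to adding it to the mean, and ρ ⊙ w + F β is linear in
(βρ, β) with matrix `coDesign`. This is where the scale factor becomes a regression coefficient. -/
theorem normalDensity_sub_scaledRestrict (f : (t : Fin (m + 1)) → D → Fin (p t) → ℝ)
    (fρ : (i : Fin m) → D → Fin (q i) → ℝ) (ψ : Params p q) (i : Fin m)
    {n n' : ℕ} (x : Fin n → D) (e : Fin n → Fin n') (R : Matrix (Fin n) (Fin n) ℝ) (v : ℝ)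
    (w : EuclideanSpace ℝ (Fin n')) (y : EuclideanSpace ℝ (Fin n)) :
    normalDensity R v (WithLp.toLp 2 (regMatrix (f i.succ) x *ᵥ fun k => (ψ.2 i).1 (Sum.inr k)))
        (y - scaledRestrict fρ ψ i x e w) =
      normalDensity R v (WithLp.toLp 2 (coDesign (regMatrix (fρ i) x) (fun j => w (e j))
        (regMatrix (f i.succ) x) *ᵥ (ψ.2 i).1.ofLp)) y := by
  rw [normalDensity_sub]
  congr 1
  ext j
  simp only [PiLp.add_apply, coDesign_mulVec]
  rfl

theorem IsARModel.indepFun_obs (h : IsARModel f fρ r Z ψ P) (i : Fin m) {n : ℕ} (x : Fin n → D)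
    {n' : Fin (m + 1) → ℕ} (x' : ∀ t, Fin (n' t) → D) :
    IndepFun (obs (discrepancy fρ Z ψ i) x)
      (fun ω (t : {t : Fin (m + 1) // t ≤ i.castSucc}) => obs (Z t) (x' t) ω) P := by
  refine (h.disc_indep i).comp (φ := fun w => WithLp.toLp 2 fun j => w (x j))
    (ψ := fun w (t : {t : Fin (m + 1) // t ≤ i.castSucc}) =>
      (WithLp.toLp 2 fun j => w (t, x' t j) : EuclideanSpace ℝ (Fin (n' t)))) ?_ ?_
  · fun_prop
  · fun_prop

theorem IsARModel.map_obs_castSucc_succ (h : IsARModel f fρ r Z ψ P) (i : Fin m) {n n' : ℕ}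
    {x : Fin n → D} {x' : Fin n' → D} {e : Fin n → Fin n'} (he : ∀ j, x j = x' (e j))
    (hR : (corrMatrix (r i.succ) x).PosDef) (hv : 0 < (ψ.2 i).2) :
    P.map (fun ω => (obs (Z i.castSucc) x' ω, obs (Z i.succ) x ω)) =
      ((P.map (obs (Z i.castSucc) x')).prod volume).withDensity fun b =>
        (krigingLik (coDesign (regMatrix (fρ i) x) (fun j => b.1 (e j)) (regMatrix (f i.succ) x))
          (corrMatrix (r i.succ) x) b.2 (ψ.2 i) : ℝ≥0∞) := by
  have := h.isProbabilityMeasure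
  have hind : IndepFun (obs (Z i.castSucc) x') (obs (discrepancy fρ Z ψ i) x) P := by
    refine ((h.disc_indep i).comp (φ := fun w => WithLp.toLp 2 fun j => w (x j))
      (ψ := fun w => WithLp.toLp 2 fun j => w (⟨i.castSucc, le_rfl⟩, x' j)) ?_ ?_).symm
    · fun_prop
    · fun_prop
  have hg : Measurable fun y => ENNReal.ofReal (normalDensity (corrMatrix (r i.succ) x) (ψ.2 i).2
      (WithLp.toLp 2 (regMatrix (f i.succ) x *ᵥ fun k => (ψ.2 i).1 (Sum.inr k))) y) :=
    (measurable_normalDensity _ measurable_const measurable_const measurable_id).ennreal_ofReal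
  have key := map_prodMk_add_eq_withDensity (measurable_obs (h.measurable i.castSucc) x')
    (measurable_obs (h.measurable_discrepancy i) x) hind hg (h.map_obs_discrepancy i hR hv)
    (measurable_scaledRestrict fρ ψ i x e)
  simp_rw [← obs_succ_eq fρ Z ψ i he, normalDensity_sub_scaledRestrict] at key
  exact key

/-- This makes the continuous conditional density unique. Lebesgue measure is absolutely continuous
with respect to the law: at level 0 the density is positive; at a successor level the joint law with
the preceding level has a positive density with respect to law(X) ⊗ volume, and one projects to the
second factor. -/
theorem IsARModel.isOpenPosMeasure_map_obs (h : IsARModel f fρ r Z ψ P) (hψ : PosVariances ψ)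
    {n : Fin (m + 1) → ℕ} {x : (t : Fin (m + 1)) → Fin (n t) → D}
    {e : (i : Fin m) → Fin (n i.succ) → Fin (n i.castSucc)}
    (he : ∀ i j, x i.succ j = x i.castSucc (e i j))
    (hR : ∀ t, (corrMatrix (r t) (x t)).PosDef) (t : Fin (m + 1)) :
    (P.map (obs (Z t) (x t))).IsOpenPosMeasure := by
  have := h.isProbabilityMeasure
  have hac : (volume : Measure (EuclideanSpace ℝ (Fin (n t)))) ≪ P.map (obs (Z t) (x t)) := by
    cases t using Fin.cases with
    | zero =>
      rw [h.map_obs_zero (hR 0) hψ.1]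
      refine withDensity_absolutelyContinuous' ?_ (ae_of_all _ fun y => ?_)
      · exact (measurable_normalDensity _ measurable_const measurable_const
          measurable_id).ennreal_ofReal.aemeasurable
      · simpa using normalDensity_pos (hR 0) hψ.1 _ y
    | succ i =>
      have hX := measurable_obs (h.measurable i.castSucc) (x i.castSucc)
      have hY := measurable_obs (h.measurable i.succ) (x i.succ)
      have := Measure.isProbabilityMeasure_map (μ := P) hX.aemeasurable
      have hprod : (P.map (obs (Z i.castSucc) (x i.castSucc))).prod
          (volume : Measure (EuclideanSpace ℝ (Fin (n i.succ)))) ≪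
          P.map (fun ω => (obs (Z i.castSucc) (x i.castSucc) ω, obs (Z i.succ) (x i.succ) ω)) := by
        rw [h.map_obs_castSucc_succ i (he i) (hR i.succ) (hψ.2 i)]
        refine withDensity_absolutelyContinuous' ?_ (ae_of_all _ fun b => ?_)
        · exact (continuous_krigingLik_coDesign _ _ _ _ (by fun_prop)
            continuous_snd).measurable.coe_nnreal_ennreal.aemeasurable
        · simpa [krigingLik] using normalDensity_pos (hR i.succ) (hψ.2 i) _ b.2
      have := hprod.map measurable_snd
      rw [Measure.map_map measurable_snd (hX.prodMk hY), Measure.map_snd_prod, measure_univ,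
        one_smul] at this
      exact this
  exact hac.isOpenPosMeasure

theorem IsARModel.map_obs (h : IsARModel f fρ r Z ψ P) (hψ : PosVariances ψ)
    {n : Fin (m + 1) → ℕ} {x : (t : Fin (m + 1)) → Fin (n t) → D}
    {e : (i : Fin m) → Fin (n i.succ) → Fin (n i.castSucc)}
    (he : ∀ i j, x i.succ j = x i.castSucc (e i j))
    (hR : ∀ t, (corrMatrix (r t) (x t)).PosDef) :
    P.map (fun ω t => obs (Z t) (x t) ω) = volume.withDensity fun y =>
      ((krigingLik (regMatrix (f 0) (x 0)) (corrMatrix (r 0) (x 0)) (y 0) ψ.1 *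
        ∏ i : Fin m, krigingLik (coDesign (regMatrix (fρ i) (x i.succ))
          (fun j => y i.castSucc (e i j)) (regMatrix (f i.succ) (x i.succ)))
          (corrMatrix (r i.succ) (x i.succ)) (y i.succ) (ψ.2 i) : ℝ≥0) : ℝ≥0∞) := by
  have := h.isProbabilityMeasure
  have hm {n : ℕ} (R : Matrix (Fin n) (Fin n) ℝ) (v : ℝ) (c : EuclideanSpace ℝ (Fin n)) :
      Measurable fun y => ENNReal.ofReal (normalDensity R v c y) :=
    (measurable_normalDensity _ measurable_const measurable_const measurable_id).ennreal_ofReal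
  have key := map_chain_eq_withDensity (E := fun t => EuclideanSpace ℝ (Fin (n t)))
    (fun t => volume) (fun t => measurable_obs (h.measurable t) (x t))
    (fun i => measurable_obs (h.measurable_discrepancy i) (x i.succ))
    (fun i => measurable_scaledRestrict fρ ψ i (x i.succ) (e i))
    (fun i ω => obs_succ_eq fρ Z ψ i (he i) ω)
    (fun i => h.indepFun_obs i (x i.succ) x) (hm _ _ _) (h.map_obs_zero (hR 0) hψ.1)
    (fun i => hm _ _ _) (fun i => h.map_obs_discrepancy i (hR i.succ) (hψ.2 i))
  simp_rw [normalDensity_sub_scaledRestrict] at key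
  rw [key]
  simp only [ENNReal.coe_mul, ENNReal.ofNNReal_finsetProd]
  rfl

end Model

/-! ### From Bayes updates to posteriors in the model -/

theorem ae_posVariances {m : ℕ} (p : Fin (m + 1) → ℕ) (q : Fin m → ℕ) :
    ∀ᵐ ψ ∂paramPrior p q, PosVariances ψ := by
  refine (Measure.quasiMeasurePreserving_fst.ae (ae_pos_jeffreysPrior _)).and
    (ae_all_iff.2 fun i => ?_)
  have h : ∀ᵐ a ∂(Measure.pi fun i : Fin m => jeffreysPrior (Fin (q i) ⊕ Fin (p i.succ))),
      0 < (a i).2 :=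
    (Measure.quasiMeasurePreserving_eval
      (fun i : Fin m => jeffreysPrior (Fin (q i) ⊕ Fin (p i.succ))) i).ae
      (p := fun a => 0 < a.2) (ae_pos_jeffreysPrior _)
  exact Measure.quasiMeasurePreserving_snd.ae h

theorem PosVariances.replaceLevel {m : ℕ} {p : Fin (m + 1) → ℕ} {q : Fin m → ℕ} {ψ : Params p q}
    (hψ : PosVariances ψ) (i : Fin m) {a : EuclideanSpace ℝ (Fin (q i) ⊕ Fin (p i.succ)) × ℝ}
    (ha : 0 < a.2) : PosVariances (replaceLevel ψ i a) := by
  refine ⟨hψ.1, fun k => ?_⟩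
  by_cases hk : k = i
  · subst hk
    simpa [CoKriging.replaceLevel] using ha
  · simpa [CoKriging.replaceLevel, hk] using hψ.2 k

theorem isPosterior_krigingLaw {ι κ : Type*} [Fintype ι] [DecidableEq ι] [Fintype κ]
    {H : Matrix ι κ ℝ} {R : Matrix ι ι ℝ} (hR : R.PosDef) {y : EuclideanSpace ℝ ι}
    {post : Measure (EuclideanSpace ℝ κ × ℝ)}
    (h : IsBayesUpdate (jeffreysPrior κ) (krigingLik H R y) post) :
    IsPosterior (jeffreysPrior κ) (krigingLaw H R) id y post := by
  refine ⟨fun a y => krigingLik H R y a, (ae_pos_jeffreysPrior κ).mono fun a ha => ⟨?_, ?_⟩, h⟩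
  · exact continuous_real_toNNReal.comp
      (continuous_normalDensity R a.2 continuous_const continuous_id)
  · rw [Measure.map_id, krigingLaw, multivariateGaussian_eq_withDensity hR ha]
    rfl

section Model

variable {m d : ℕ} {p : Fin (m + 1) → ℕ} {q : Fin m → ℕ} {D : Set (EuclideanSpace ℝ (Fin d))}
  {Ω : Type*} [MeasurableSpace Ω] {f : (t : Fin (m + 1)) → D → Fin (p t) → ℝ}
  {fρ : (i : Fin m) → D → Fin (q i) → ℝ} {r : Fin (m + 1) → EuclideanSpace ℝ (Fin d) → ℝ}
  {Z : Fin (m + 1) → D → Ω → ℝ} {P : Params p q → Measure Ω}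

/-- The map `φ` inserts the unknown `a` into the full parameter vector, so that known variance and
Jeffreys prior are both covered. -/
theorem isPosterior_obs_zero {Par : Type*} [MeasurableSpace Par] {prior post : Measure Par}
    {φ : Par → Params p q} {n : ℕ} {x : Fin n → D} {z : EuclideanSpace ℝ (Fin n)}
    (hP : ∀ ψ, PosVariances ψ → IsARModel f fρ r Z ψ (P ψ))
    (hR : (corrMatrix (r 0) x).PosDef) (hφ : ∀ᵐ a ∂prior, PosVariances (φ a))
    (h : IsBayesUpdate prior
      (fun a => krigingLik (regMatrix (f 0) x) (corrMatrix (r 0) x) z (φ a).1) post) :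
    IsPosterior prior (fun a => P (φ a)) (obs (Z 0) x) z post := by
  refine ⟨fun a y => krigingLik (regMatrix (f 0) x) (corrMatrix (r 0) x) y (φ a).1,
    hφ.mono fun a ha => ⟨?_, (hP _ ha).map_obs_zero hR ha.1⟩, h⟩
  exact continuous_real_toNNReal.comp
    (continuous_normalDensity _ _ continuous_const continuous_id)

theorem isCondPosterior_obs_succ {Par : Type*} [MeasurableSpace Par] {prior post : Measure Par}
    {φ : Par → Params p q}
    {n : Fin (m + 1) → ℕ} {x : (t : Fin (m + 1)) → Fin (n t) → D}
    {e : (i : Fin m) → Fin (n i.succ) → Fin (n i.castSucc)}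
    (he : ∀ i j, x i.succ j = x i.castSucc (e i j))
    (hP : ∀ ψ, PosVariances ψ → IsARModel f fρ r Z ψ (P ψ))
    (hR : ∀ t, (corrMatrix (r t) (x t)).PosDef) (hφ : ∀ᵐ a ∂prior, PosVariances (φ a))
    {z : (t : Fin (m + 1)) → EuclideanSpace ℝ (Fin (n t))} {i : Fin m}
    (h : IsBayesUpdate prior (fun a => krigingLik (coDesign (regMatrix (fρ i) (x i.succ))
      (fun j => z i.castSucc (e i j)) (regMatrix (f i.succ) (x i.succ)))
      (corrMatrix (r i.succ) (x i.succ)) (z i.succ) ((φ a).2 i)) post) :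
    IsCondPosterior prior (fun a => P (φ a)) (obs (Z i.castSucc) (x i.castSucc)) (z i.castSucc)
      (obs (Z i.succ) (x i.succ)) (z i.succ) post := by
  refine ⟨fun a b => krigingLik (coDesign (regMatrix (fρ i) (x i.succ))
      (fun j => b.1 (e i j)) (regMatrix (f i.succ) (x i.succ)))
      (corrMatrix (r i.succ) (x i.succ)) b.2 ((φ a).2 i),
    hφ.mono fun a ha => ⟨(hP _ ha).isOpenPosMeasure_map_obs ha he hR _,
      continuous_krigingLik_coDesign _ _ _ _ (by fun_prop) continuous_snd,
      (hP _ ha).map_obs_castSucc_succ i (he i) (hR i.succ) (ha.2 i)⟩, h⟩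

/-- At the fixed data z each factor of the joint density involves the parameters of one level only,
with a constant design matrix, so likelihood and prior are products over the same blocks. -/
theorem isPosterior_obs
    {n : Fin (m + 1) → ℕ} {x : (t : Fin (m + 1)) → Fin (n t) → D}
    {e : (i : Fin m) → Fin (n i.succ) → Fin (n i.castSucc)}
    (he : ∀ i j, x i.succ j = x i.castSucc (e i j))
    (hP : ∀ ψ, PosVariances ψ → IsARModel f fρ r Z ψ (P ψ))
    (hR : ∀ t, (corrMatrix (r t) (x t)).PosDef)
    {z : (t : Fin (m + 1)) → EuclideanSpace ℝ (Fin (n t))}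
    {post₀ : Measure (EuclideanSpace ℝ (Fin (p 0)) × ℝ)}
    {post : (i : Fin m) → Measure (EuclideanSpace ℝ (Fin (q i) ⊕ Fin (p i.succ)) × ℝ)}
    (h₀ : IsBayesUpdate (jeffreysPrior (Fin (p 0)))
      (krigingLik (regMatrix (f 0) (x 0)) (corrMatrix (r 0) (x 0)) (z 0)) post₀)
    (h : ∀ i, IsBayesUpdate (jeffreysPrior (Fin (q i) ⊕ Fin (p i.succ)))
      (krigingLik (coDesign (regMatrix (fρ i) (x i.succ))
        (fun j => z i.castSucc (e i j)) (regMatrix (f i.succ) (x i.succ)))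
        (corrMatrix (r i.succ) (x i.succ)) (z i.succ)) (post i)) :
    IsPosterior (paramPrior p q) P (fun ω t => obs (Z t) (x t) ω) z
      (post₀.prod (Measure.pi post)) := by
  refine ⟨fun ψ y => krigingLik (regMatrix (f 0) (x 0)) (corrMatrix (r 0) (x 0)) (y 0) ψ.1 *
        ∏ i : Fin m, krigingLik (coDesign (regMatrix (fρ i) (x i.succ))
          (fun j => y i.castSucc (e i j)) (regMatrix (f i.succ) (x i.succ)))
          (corrMatrix (r i.succ) (x i.succ)) (y i.succ) (ψ.2 i),
    (ae_posVariances p q).mono fun ψ hψ => ⟨?_, (hP ψ hψ).map_obs hψ he hR⟩, ?_⟩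
  · refine Continuous.mul ?_ (continuous_finsetProd _ fun i _ => ?_)
    · exact continuous_real_toNNReal.comp
        (continuous_normalDensity _ _ continuous_const (continuous_apply 0))
    · exact continuous_krigingLik_coDesign _ _ _ _ (by fun_prop) (continuous_apply i.succ)
  · exact h₀.prod (measurable_krigingLik _ _ _)
      (Finset.measurable_prod _ fun i _ =>
        (measurable_krigingLik _ _ _).comp (measurable_pi_apply i))
      (IsBayesUpdate.pi (fun i => measurable_krigingLik _ _ _) h)

end Model

end CoKriging

end

/-! ### Assembly of the level-wise and joint posteriors -/

theorem mainTheorem4 {m d : ℕ} (n p : Fin (m + 1) → ℕ) (q : Fin m → ℕ)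
    -- input space and nested design sets, `x t` listing the points of `D_t`
    (D : Set (EuclideanSpace ℝ (Fin d))) (x : (t : Fin (m + 1)) → Fin (n t) → D)
    (e : (i : Fin m) → Fin (n i.succ) → Fin (n i.castSucc))
    (he : ∀ i j, x i.succ j = x i.castSucc (e i j))
    -- regression functions, correlation functions and their hyper-parameters
    (f : (t : Fin (m + 1)) → D → Fin (p t) → ℝ) (fρ : (i : Fin m) → D → Fin (q i) → ℝ)
    {Θ : Fin (m + 1) → Type*} (θ : (t : Fin (m + 1)) → Θ t)
    (r : (t : Fin (m + 1)) → EuclideanSpace ℝ (Fin d) → Θ t → ℝ)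
    (R : (t : Fin (m + 1)) → Matrix (Fin (n t)) (Fin (n t)) ℝ)
    (hR : ∀ t, R t = CoKriging.corrMatrix (fun h => r t h (θ t)) (x t))
    (hRpos : ∀ t, (R t).PosDef)
    -- the processes, and their law `P ψ` given the parameters `ψ`
    {Ω : Type*} [MeasurableSpace Ω] (Z : Fin (m + 1) → D → Ω → ℝ)
    (P : CoKriging.Params p q → Measure Ω)
    (hP : ∀ ψ, CoKriging.PosVariances ψ →
      CoKriging.IsARModel f fρ (fun t h => r t h (θ t)) Z ψ (P ψ))
    -- the observations and the resulting design matrices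
    (z : (t : Fin (m + 1)) → EuclideanSpace ℝ (Fin (n t)))
    (F : Matrix (Fin (n 0)) (Fin (p 0)) ℝ) (hF : F = CoKriging.regMatrix (f 0) (x 0))
    (H : (i : Fin m) → Matrix (Fin (n i.succ)) (Fin (q i) ⊕ Fin (p i.succ)) ℝ)
    (hH : ∀ i, H i = CoKriging.coDesign (CoKriging.regMatrix (fρ i) (x i.succ))
      (fun j => z i.castSucc (e i j)) (CoKriging.regMatrix (f i.succ) (x i.succ))) :
    -- posterior of the coefficients of a level `t ≥ 2` given `z_t`, `z_{t-1}` and the variance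
    (∀ i, LinearIndependent ℝ (H i).col → ∀ ψ, CoKriging.PosVariances ψ → ∀ v : ℝ, 0 < v →
      CoKriging.IsCondPosterior volume (fun b => P (CoKriging.replaceLevel ψ i (b, v)))
        (CoKriging.obs (Z i.castSucc) (x i.castSucc)) (z i.castSucc)
        (CoKriging.obs (Z i.succ) (x i.succ)) (z i.succ)
        (multivariateGaussian (CoKriging.coefMean (H i) (R i.succ) (z i.succ))
          (v • CoKriging.coefCov (H i) (R i.succ)))) ∧
    -- joint posterior of coefficients and variance of a level `t ≥ 2` given `z_t`, `z_{t-1}`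
    (∀ i, LinearIndependent ℝ (H i).col →
      (¬ ∃ b : Fin (q i) ⊕ Fin (p i.succ) → ℝ, (z i.succ).ofLp = H i *ᵥ b) →
      ∃ post : Measure (EuclideanSpace ℝ (Fin (q i) ⊕ Fin (p i.succ)) × ℝ),
        (∀ ψ, CoKriging.PosVariances ψ →
          CoKriging.IsCondPosterior (CoKriging.jeffreysPrior (Fin (q i) ⊕ Fin (p i.succ)))
            (fun a => P (CoKriging.replaceLevel ψ i a))
            (CoKriging.obs (Z i.castSucc) (x i.castSucc)) (z i.castSucc)
            (CoKriging.obs (Z i.succ) (x i.succ)) (z i.succ) post) ∧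
        CoKriging.IsGaussianInvGamma (H i) (R i.succ) (z i.succ)
          (((n i.succ : ℝ) - (p i.succ : ℝ) - (q i : ℝ)) / 2) post) ∧
    -- the same for the first level
    (LinearIndependent ℝ F.col → ∀ ψ, CoKriging.PosVariances ψ → ∀ v : ℝ, 0 < v →
      CoKriging.IsPosterior volume (fun b => P ((b, v), ψ.2))
        (CoKriging.obs (Z 0) (x 0)) (z 0)
        (multivariateGaussian (CoKriging.coefMean F (R 0) (z 0))
          (v • CoKriging.coefCov F (R 0)))) ∧
    (LinearIndependent ℝ F.col → (¬ ∃ b : Fin (p 0) → ℝ, (z 0).ofLp = F *ᵥ b) →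
      ∃ post : Measure (EuclideanSpace ℝ (Fin (p 0)) × ℝ),
        (∀ ψ, CoKriging.PosVariances ψ →
          CoKriging.IsPosterior (CoKriging.jeffreysPrior (Fin (p 0))) (fun a => P (a, ψ.2))
            (CoKriging.obs (Z 0) (x 0)) (z 0) post) ∧
        CoKriging.IsGaussianInvGamma F (R 0) (z 0) (((n 0 : ℝ) - (p 0 : ℝ)) / 2) post) ∧
    -- the posterior of all parameters given all observations is the product of the posteriors
    -- of independent one-level krigings with design matrices `F` and `H i`
    (LinearIndependent ℝ F.col → (¬ ∃ b : Fin (p 0) → ℝ, (z 0).ofLp = F *ᵥ b) →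
      (∀ i, LinearIndependent ℝ (H i).col) →
      (∀ i, ¬ ∃ b : Fin (q i) ⊕ Fin (p i.succ) → ℝ, (z i.succ).ofLp = H i *ᵥ b) →
      ∃ (post₀ : Measure (EuclideanSpace ℝ (Fin (p 0)) × ℝ))
        (post : (i : Fin m) → Measure (EuclideanSpace ℝ (Fin (q i) ⊕ Fin (p i.succ)) × ℝ)),
        CoKriging.IsPosterior (CoKriging.jeffreysPrior (Fin (p 0)))
          (CoKriging.krigingLaw F (R 0)) id (z 0) post₀ ∧
        CoKriging.IsGaussianInvGamma F (R 0) (z 0) (((n 0 : ℝ) - (p 0 : ℝ)) / 2) post₀ ∧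
        (∀ i, CoKriging.IsPosterior (CoKriging.jeffreysPrior (Fin (q i) ⊕ Fin (p i.succ)))
            (CoKriging.krigingLaw (H i) (R i.succ)) id (z i.succ) (post i) ∧
          CoKriging.IsGaussianInvGamma (H i) (R i.succ) (z i.succ)
            (((n i.succ : ℝ) - (p i.succ : ℝ) - (q i : ℝ)) / 2) (post i)) ∧
        CoKriging.IsPosterior (CoKriging.paramPrior p q) P
          (fun ω (t : Fin (m + 1)) => CoKriging.obs (Z t) (x t) ω) z
          (post₀.prod (Measure.pi post))) := by
  have hRpos' : ∀ t, (CoKriging.corrMatrix (fun h => r t h (θ t)) (x t)).PosDef :=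
    fun t => hR t ▸ hRpos t
  have hα (i : Fin m) : ((n i.succ : ℝ) - (p i.succ : ℝ) - (q i : ℝ)) / 2 =
      ((Fintype.card (Fin (n i.succ)) : ℝ) - Fintype.card (Fin (q i) ⊕ Fin (p i.succ))) / 2 := by
    simp only [Fintype.card_fin, Fintype.card_sum, Nat.cast_add]
    ring
  have hα₀ : ((n 0 : ℝ) - (p 0 : ℝ)) / 2 =
      ((Fintype.card (Fin (n 0)) : ℝ) - Fintype.card (Fin (p 0))) / 2 := by
    simp only [Fintype.card_fin]
  refine ⟨fun i hi ψ hψ v hv => ?_, fun i hi hz => ?_, fun hF' ψ hψ v hv => ?_,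
    fun hF' hz => ?_, fun hF' hz₀ hH' hz => ?_⟩
  · refine CoKriging.isCondPosterior_obs_succ
      (φ := fun b => CoKriging.replaceLevel ψ i (b, v)) he hP hRpos'
      (ae_of_all _ fun b => hψ.replaceLevel i hv) ?_
    simp only [CoKriging.replaceLevel, Function.update_self]
    rw [← hH i, ← hR i.succ]
    exact CoKriging.isBayesUpdate_coef (hRpos i.succ) hi (z i.succ) hv
  · obtain ⟨post, hpost, hG⟩ := CoKriging.exists_isBayesUpdate_isGaussianInvGamma
      (hRpos i.succ) hi hz (hα i)
    -- The likelihood of level i does not see the other levels, so one `post` serves every `ψ`.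
    refine ⟨post, fun ψ hψ => ?_, hG⟩
    refine CoKriging.isCondPosterior_obs_succ
      (φ := fun a => CoKriging.replaceLevel ψ i a) he hP hRpos'
      ((CoKriging.ae_pos_jeffreysPrior _).mono fun a ha => hψ.replaceLevel i ha) ?_
    simp only [CoKriging.replaceLevel, Function.update_self]
    rw [← hH i, ← hR i.succ]
    exact hpost
  · refine CoKriging.isPosterior_obs_zero (φ := fun b => ((b, v), ψ.2)) hP (hRpos' 0)
      (ae_of_all _ fun b => ⟨hv, hψ.2⟩) ?_
    rw [← hF, ← hR 0]
    exact CoKriging.isBayesUpdate_coef (hRpos 0) hF' (z 0) hv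
  · obtain ⟨post, hpost, hG⟩ := CoKriging.exists_isBayesUpdate_isGaussianInvGamma
      (hRpos 0) hF' hz hα₀
    refine ⟨post, fun ψ hψ => ?_, hG⟩
    refine CoKriging.isPosterior_obs_zero (φ := fun a => (a, ψ.2)) hP (hRpos' 0)
      ((CoKriging.ae_pos_jeffreysPrior _).mono fun a ha => ⟨ha, hψ.2⟩) ?_
    rw [← hF, ← hR 0]
    exact hpost
  · obtain ⟨post₀, hpost₀, hG₀⟩ := CoKriging.exists_isBayesUpdate_isGaussianInvGamma
      (hRpos 0) hF' hz₀ hα₀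
    have hex (i : Fin m) := CoKriging.exists_isBayesUpdate_isGaussianInvGamma
      (hRpos i.succ) (hH' i) (hz i) (hα i)
    choose post hpost hG using hex
    refine ⟨post₀, post, CoKriging.isPosterior_krigingLaw (hRpos 0) hpost₀, hG₀,
      fun i => ⟨CoKriging.isPosterior_krigingLaw (hRpos i.succ) (hpost i), hG i⟩, ?_⟩
    refine CoKriging.isPosterior_obs he hP hRpos' ?_ fun i => ?_
    · rw [← hF, ← hR 0]
      exact hpost₀
    · rw [← hH i, ← hR i.succ]
      exact hpost i
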